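/- Let $F$ be a probability distribution on $(0,\infty)$ with finite mean and $G$ a probability distribution on $[0,1]$. Let $\tau=(\tau_k)_{k\in\mathbb Z}$ be i.i.d. with law $F$, let $(b_k)_{k\in\mathbb Z}$ be i.i.d. with law $G$ and independent of $\tau$, and define the exchange operator by $$\Phi_G(\tau)=(\tau'_k)_{k\in\mathbb Z},\qquad \tau'_k=(1-b_k)\tau_k+b_{k+1}\tau_{k+1}.$$ Let $T$ be a stationary renewal process on $\mathbb R$ with interpoint law $F$, i.e. a stationary point process whose successive interpoint lengths are, under the Palm distribution, i.i.d. with law $F$. Let $\Psi_G(T)$ be the set of all points $x+b_I(y-x)$, where $I=(x,y)$ runs through the intervals between consecutive points of $T$ and the $b_I$ are i.i.d. with law $G$, independent of $T$. Then each of the two statements $\Phi_G(\tau)\overset{d}{=}\tau$ and $\Psi_G(T)\overset{d}{=}T$ holds if and only if at least one of the following is true: (i) $F=\Gamma(\alpha,\gamma)$ (shape $\alpha$, rate $\gamma$) and $G=\mathrm{Beta}(r\alpha,(1-r)\alpha)$ for some $\alpha>0$, $\gamma>0$ and $r\in(0,1)$; (ii) $F=\delta_s$ for some $s\in(0,\infty)$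 and $G=\delta_b$ for some $b\in[0,1]$; (iii) $G=\delta_0$ or $G=\delta_1$ (with $F$ arbitrary). -/

import Mathlib

open MeasureTheory ProbabilityTheory Filter Set
open scoped ENNReal

/-- `X = (X_k)` is a family of i.i.d. real random variables with law `μ`. -/
structure IsIID {ι Ω : Type*} [MeasurableSpace Ω] (X : ι → Ω → ℝ) (μ : Measure ℝ)
    (P : Measure Ω) : Prop where
  measurable : ∀ k, Measurable (X k)
  law : ∀ k, P.map (X k) = μ
  indep : iIndepFun X P

/-- The two (whole) sequences `X` and `Y` are independent of each other. -/
def IndepSeq {Ω : Type*} [MeasurableSpace Ω] (X Y : ℤ → Ω → ℝ) (P : Measure Ω) : Prop :=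
  IndepFun (fun ω k => X k ω) (fun ω k => Y k ω) P

/-- The exchange operator with proportions `b`:
`τ'_k = (1 - b_k) τ_k + b_{k+1} τ_{k+1}`. -/
def exchange (b τ : ℤ → ℝ) : ℤ → ℝ :=
  fun k => (1 - b k) * τ k + b (k + 1) * τ (k + 1)

/-- For a bi-infinite increasing sequence of points `t`, with intervals
`I_k = (t_{k-1}, t_k)`, the set of division points `c(I_k) = x + b_k (y - x)`,
`I_k = (x, y)`. -/
def divisionPoints (b t : ℤ → ℝ) : Set ℝ :=
  range fun k => t (k - 1) + b k * (t k - t (k - 1))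

/-- Two random subsets of the line have the same law as point processes: for all finite
families of Borel sets the vectors of numbers of points have the same joint law. -/
def SamePointProcessLaw {Ω Ω' : Type*} [MeasurableSpace Ω] [MeasurableSpace Ω']
    (S : Ω → Set ℝ) (P : Measure Ω) (S' : Ω' → Set ℝ) (P' : Measure Ω') : Prop :=
  ∀ (n : ℕ) (B : Fin n → Set ℝ), (∀ i, MeasurableSet (B i)) →
    IdentDistrib (fun ω i => (S ω ∩ B i).encard) (fun ω i => (S' ω ∩ B i).encard) P P'

/-- `T` is a measurable increasing enumeration of a point process on the line that is almost
surely without accumulation points and unbounded in both directions.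
The point process itself is the random set `range (fun k => T k ω)`; no convention is made on
which of its points is `T 0 ω`. -/
structure IsPointEnumeration {Ω : Type*} [MeasurableSpace Ω] (T : ℤ → Ω → ℝ)
    (P : Measure Ω) : Prop where
  measurable : ∀ k, Measurable (T k)
  strictMono : ∀ᵐ ω ∂P, StrictMono fun k => T k ω
  tendsto_atTop : ∀ᵐ ω ∂P, Tendsto (fun k => T k ω) atTop atTop
  tendsto_atBot : ∀ᵐ ω ∂P, Tendsto (fun k => T k ω) atBot atBot

/-- The law of the point process enumerated by `T` is invariant under all translations. -/
def IsStationaryPP {Ω : Type*} [MeasurableSpace Ω] (T : ℤ → Ω → ℝ) (P : Measure Ω) : Prop :=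
  ∀ t : ℝ, SamePointProcessLaw (fun ω => range fun k => T k ω + t) P
    (fun ω => range fun k => T k ω) P

/-- The sequence of interpoint lengths of `t` as seen from its point `t n`: the entry at `k` is
`t (n + k) - t (n + k - 1)`. -/
def gapsFrom (t : ℤ → ℝ) (n : ℤ) : ℤ → ℝ :=
  fun k => t (n + k) - t (n + k - 1)

/-- `Q` is the law of the sequence of interpoint lengths under the Palm distribution of the
point process enumerated by `T`: for some intensity `ρ ∈ (0, ∞)`, the expected number of points
that lie in `B` and from which the interpoint lengths are seen to be in `A` is `ρ |B| Q(A)`. -/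
def HasPalmGapLaw {Ω : Type*} [MeasurableSpace Ω] (T : ℤ → Ω → ℝ) (Q : Measure (ℤ → ℝ))
    (P : Measure Ω) : Prop :=
  ∃ ρ : ℝ≥0∞, ρ ≠ 0 ∧ ρ ≠ ∞ ∧
    ∀ (B : Set ℝ) (A : Set (ℤ → ℝ)), MeasurableSet B → MeasurableSet A →
      ∑' n : ℤ, P {ω | T n ω ∈ B ∧ gapsFrom (fun k => T k ω) n ∈ A} = ρ * volume B * Q A

/-- `T` enumerates a stationary renewal process with interpoint law `F`: a stationary point
process whose interpoint lengths are, under the Palm distribution, i.i.d. with law `F`. -/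
structure IsStationaryRenewal {Ω : Type*} [MeasurableSpace Ω] (T : ℤ → Ω → ℝ) (F : Measure ℝ)
    [IsProbabilityMeasure F] (P : Measure Ω) : Prop where
  enumeration : IsPointEnumeration T P
  stationary : IsStationaryPP T P
  palm : HasPalmGapLaw T (Measure.infinitePi fun _ : ℤ => F) P

/-- The alternatives for the interpoint law `F` and the division law `G`:
(i) gamma (shape, rate) and beta; (ii) both degenerate; (iii) the trivial division laws,
for which every point moves to itself or to its right neighbour. -/
def FixedPointAlternatives (F G : Measure ℝ) : Prop :=
  (∃ α γ r : ℝ, 0 < α ∧ 0 < γ ∧ 0 < r ∧ r < 1 ∧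
      F = gammaMeasure α γ ∧ G = betaMeasure (r * α) ((1 - r) * α)) ∨
  (∃ s b : ℝ, 0 < s ∧ 0 ≤ b ∧ b ≤ 1 ∧ F = Measure.dirac s ∧ G = Measure.dirac b) ∨
  (G = Measure.dirac 0 ∨ G = Measure.dirac 1)

/-!
Why the theorem is true. An interval of length `τ ∼ F` is divided into the parts
`X = (1 - b) τ` and `Y = b τ`; `pairLaw F G` is the law of `(X, Y)`, and the exchanged sequence is
`X_k + Y_{k+1}` for i.i.d. pairs `(X_k, Y_k)`.

If `X` and `Y` are independent, all the `X_k`, `Y_k` are, so regrouping does not change the law of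
the sequence (`exchangeLaw_eq_of_pairLaw_eq_prod`). Conversely, if two consecutive entries of the
exchanged sequence are independent with law `F`, then the product `E e^{-sX} E e^{-tX-sY} E e^{-tY}`
equals `E e^{-sX} E e^{-sY} E e^{-tX} E e^{-tY}`; Laplace transforms of nonnegative variables do not
vanish, so `X` and `Y` are independent (`pairLaw_eq_prod_of_consecutive`). Thus everything reduces
to Lukacs' theorem: `X` and `Y` are independent exactly under the alternatives.
* One direction is the beta-gamma change of variables (`gamma_prod_beta_map`).
* For the other (`fixedPointAlternatives_of_pairLaw_eq_prod`), let `h`, `g` be the transforms of `τ`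
  and `Y`. Independence of `X` and `Y` and of `b` and `τ` gives `g' h = E b · h' g` and
  `g'' h = E b² · h'' g`, whence `E[b (1 - b)] h'' h = E b (1 - E b) h'²`. So either
  `b ∈ {0, 1}` is constant or `h / h'` is affine, which makes the transforms exponential or gamma.

For point processes, `palmMeasure T P` is the Campbell measure of (location, gap sequence). For a
renewal process it is a multiple of Lebesgue measure times the i.i.d. law, and for the division
points it is the same multiple of Lebesgue measure times the (shifted) exchanged law
(`palmMeasure_divisionPoint`). Summing over the unique index of the first nonnegative point gives
an inversion formula (`measure_eq_palmMeasure`), so the Palm measure determines the law of the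
process. Conversely the law of the process determines the joint law of the successive points to the
right of the origin, hence that of the gaps there, which is the Palm law biased by the length of the
gap over the origin. Both for i.i.d. and for exchanged gaps that gap is independent of the gaps two
and three steps ahead, so the bias disappears for these (`map_gaps_restrict_firstPointSet`) and the
statement about two consecutive entries of the exchanged sequence applies. Division points that
coincide are counted once, which would lower the intensity; equality in law excludes this
(`dividedGapLaw_eq_zero_of_samePointProcessLaw`).
-/

open scoped NNReal BoundedContinuousFunction Topology

/-! ### Uniqueness of the bivariate Laplace transform -/

/-- The bounded continuous function `(x, y) ↦ exp (-(s x + t y))` on the quadrant. -/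
noncomputable def laplaceKernel (w : Multiplicative (ℝ≥0 × ℝ≥0)) : (ℝ≥0 × ℝ≥0) →ᵇ ℝ :=
  BoundedContinuousFunction.ofNormedAddCommGroup
    (fun p => Real.exp (-((w.toAdd.1 : ℝ) * p.1 + (w.toAdd.2 : ℝ) * p.2)))
    (by fun_prop) 1 (fun p => by
      rw [Real.norm_eq_abs, Real.abs_exp, Real.exp_le_one_iff]
      have : (0 : ℝ) ≤ (w.toAdd.1 : ℝ) * p.1 + (w.toAdd.2 : ℝ) * p.2 := by positivity
      linarith)

lemma laplaceKernel_apply (w : Multiplicative (ℝ≥0 × ℝ≥0)) (p : ℝ≥0 × ℝ≥0) :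
    laplaceKernel w p = Real.exp (-((w.toAdd.1 : ℝ) * p.1 + (w.toAdd.2 : ℝ) * p.2)) := rfl

/-- Exponentials multiply to exponentials, so they span an algebra. -/
noncomputable def laplaceHom : Multiplicative (ℝ≥0 × ℝ≥0) →* ((ℝ≥0 × ℝ≥0) →ᵇ ℝ) where
  toFun := laplaceKernel
  map_one' := by ext p; simp [laplaceKernel_apply]
  map_mul' v w := by
    ext p
    simp only [laplaceKernel_apply, BoundedContinuousFunction.coe_mul, Pi.mul_apply,
      ← Real.exp_add, toAdd_mul, Prod.fst_add, Prod.snd_add, NNReal.coe_add]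
    congr 1; ring

/-- The algebra of exponential polynomials on the quadrant. -/
noncomputable def laplaceAlgebra : StarSubalgebra ℝ ((ℝ≥0 × ℝ≥0) →ᵇ ℝ) where
  toSubalgebra := Algebra.adjoin ℝ (MonoidHom.mrange laplaceHom : Set ((ℝ≥0 × ℝ≥0) →ᵇ ℝ))
  star_mem' := by
    intro f hf
    have : star f = f := by ext p; simp
    exact this ▸ hf

lemma ext_of_laplace_nnreal {P Q : Measure (ℝ≥0 × ℝ≥0)} [IsFiniteMeasure P] [IsFiniteMeasure Q]
    (h : ∀ w, ∫ p, laplaceKernel w p ∂P = ∫ p, laplaceKernel w p ∂Q) : P = Q := by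
  apply ext_of_forall_mem_subalgebra_integral_eq_of_polish (A := laplaceAlgebra)
  · intro x y hxy
    have key : ∀ w, ∃ f ∈ ((fun f : C(ℝ≥0 × ℝ≥0, ℝ) => (f : ℝ≥0 × ℝ≥0 → ℝ)) ''
        ((laplaceAlgebra.map (BoundedContinuousFunction.toContinuousMapStarₐ ℝ) :
          StarSubalgebra ℝ C(ℝ≥0 × ℝ≥0, ℝ)) : Set C(ℝ≥0 × ℝ≥0, ℝ))),
        ∀ p, f p = laplaceKernel w p := by
      intro w
      refine ⟨_, ⟨_, ⟨laplaceKernel w, Algebra.subset_adjoin ⟨w, rfl⟩, rfl⟩, rfl⟩, fun p => rfl⟩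
    by_cases h1 : x.1 = y.1
    · have h2 : x.2 ≠ y.2 := fun h2 => hxy (Prod.ext h1 h2)
      obtain ⟨f, hf, hfe⟩ := key (Multiplicative.ofAdd (0, 1))
      refine ⟨f, hf, ?_⟩
      rw [hfe, hfe, laplaceKernel_apply, laplaceKernel_apply]
      simpa [Real.exp_eq_exp] using h2
    · obtain ⟨f, hf, hfe⟩ := key (Multiplicative.ofAdd (1, 0))
      refine ⟨f, hf, ?_⟩
      rw [hfe, hfe, laplaceKernel_apply, laplaceKernel_apply]
      simpa [Real.exp_eq_exp] using h1
  · intro g hg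
    have hg' : g ∈ Submodule.span ℝ (MonoidHom.mrange laplaceHom : Set ((ℝ≥0 × ℝ≥0) →ᵇ ℝ)) := by
      have hg2 : g ∈ Algebra.adjoin ℝ
        (MonoidHom.mrange laplaceHom : Set ((ℝ≥0 × ℝ≥0) →ᵇ ℝ)) := hg
      rwa [← Subalgebra.mem_toSubmodule, Algebra.adjoin_eq_span, Submonoid.closure_eq] at hg2
    clear hg
    induction hg' using Submodule.span_induction with
    | mem f hf => obtain ⟨w, rfl⟩ := hf; exact h w
    | zero => simp
    | add f g _ _ hf hg =>
      simp only [BoundedContinuousFunction.coe_add, Pi.add_apply]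
      rw [integral_add (f.integrable P) (g.integrable P),
        integral_add (f.integrable Q) (g.integrable Q), hf, hg]
    | smul c f _ hf =>
      simp only [BoundedContinuousFunction.coe_smul, integral_smul, hf]

/-- Uniqueness of the bivariate Laplace transform. -/
lemma ext_of_laplace {P Q : Measure (ℝ × ℝ)} [IsFiniteMeasure P] [IsFiniteMeasure Q]
    (hP : ∀ᵐ p ∂P, 0 ≤ p.1 ∧ 0 ≤ p.2) (hQ : ∀ᵐ p ∂Q, 0 ≤ p.1 ∧ 0 ≤ p.2)
    (h : ∀ s t : ℝ, 0 ≤ s → 0 ≤ t →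
      ∫ p, Real.exp (-(s * p.1 + t * p.2)) ∂P = ∫ p, Real.exp (-(s * p.1 + t * p.2)) ∂Q) :
    P = Q := by
  set r : ℝ × ℝ → ℝ≥0 × ℝ≥0 := fun p => (p.1.toNNReal, p.2.toNNReal) with hr
  have hrm : Measurable r := by fun_prop
  set e : ℝ≥0 × ℝ≥0 → ℝ × ℝ := fun p => (p.1, p.2) with he
  have hem : Measurable e := by fun_prop
  have back : ∀ M : Measure (ℝ × ℝ), (∀ᵐ p ∂M, 0 ≤ p.1 ∧ 0 ≤ p.2) → (M.map r).map e = M := by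
    intro M hR
    rw [Measure.map_map hem hrm]
    conv_rhs => rw [← Measure.map_id (μ := M)]
    refine Measure.map_congr ?_
    filter_upwards [hR] with p hp
    simp [e, r, hp.1, hp.2]
  have hint : ∀ M : Measure (ℝ × ℝ), (∀ᵐ p ∂M, 0 ≤ p.1 ∧ 0 ≤ p.2) → ∀ w,
      ∫ p, laplaceKernel w p ∂(M.map r)
        = ∫ p, Real.exp (-((w.toAdd.1 : ℝ) * p.1 + (w.toAdd.2 : ℝ) * p.2)) ∂M := by
    intro M hR w
    rw [integral_map hrm.aemeasurable (laplaceKernel w).continuous.aestronglyMeasurable]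
    refine integral_congr_ae ?_
    filter_upwards [hR] with p hp
    simp [laplaceKernel_apply, r, hp.1, hp.2]
  rw [← back P hP, ← back Q hQ]
  have : IsFiniteMeasure (P.map r) := Measure.isFiniteMeasure_map _ _
  have : IsFiniteMeasure (Q.map r) := Measure.isFiniteMeasure_map _ _
  congr 1
  refine ext_of_laplace_nnreal fun w => ?_
  rw [hint P hP, hint Q hQ]
  exact h _ _ (by positivity) (by positivity)

/-! ### Pairs of i.i.d. sequences -/

/-- The whole space, a square cylinder, spans a product of probability measures. -/
def infinitePiSpanningSets {ι γ : Type*} [MeasurableSpace γ] (κ : Measure γ)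
    [IsProbabilityMeasure κ] : (Measure.infinitePi fun _ : ι => κ).FiniteSpanningSetsIn
      (squareCylinders fun _ : ι => {s : Set γ | MeasurableSet s}) where
  set _ := univ
  set_mem _ := ⟨∅, fun _ => univ, by simp, by simp⟩
  finite _ := by simp
  spanning := by simp [iUnion_const]

/-- The sequence of pairs of two independent i.i.d. sequences is i.i.d. -/
lemma infinitePi_prod_map_zip {ι α β : Type*} [MeasurableSpace α] [MeasurableSpace β]
    (μ : Measure α) (ν : Measure β) [IsProbabilityMeasure μ] [IsProbabilityMeasure ν] :
    ((Measure.infinitePi fun _ : ι => μ).prod (Measure.infinitePi fun _ : ι => ν)).map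
      (fun p k => (p.1 k, p.2 k)) = Measure.infinitePi fun _ : ι => μ.prod ν := by
  set z : (ι → α) × (ι → β) → ι → α × β := fun p k => (p.1 k, p.2 k) with hz
  have hzm : Measurable z := by fun_prop
  set u : (ι → α × β) → (ι → α) × (ι → β) := fun q => (fun k => (q k).1, fun k => (q k).2) with hu
  have hum : Measurable u := by fun_prop
  suffices h : (Measure.infinitePi fun _ : ι => μ).prod (Measure.infinitePi fun _ : ι => ν)
      = (Measure.infinitePi fun _ : ι => μ.prod ν).map u by
    rw [h, Measure.map_map hzm hum]
    have : z ∘ u = id := rfl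
    rw [this, Measure.map_id]
  refine Measure.prod_eq_generateFrom (generateFrom_squareCylinders)
    (generateFrom_squareCylinders) (isPiSystem_squareCylinders
      (fun _ => MeasurableSpace.isPiSystem_measurableSet) (fun _ => MeasurableSet.univ))
      (isPiSystem_squareCylinders
      (fun _ => MeasurableSpace.isPiSystem_measurableSet) (fun _ => MeasurableSet.univ))
      (infinitePiSpanningSets μ) (infinitePiSpanningSets ν) ?_
  rintro _ ⟨s, A, hA, rfl⟩ _ ⟨t, B, hB, rfl⟩
  classical
  have hA' : ∀ i, MeasurableSet (A i) := fun i => hA i (mem_univ i)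
  have hB' : ∀ i, MeasurableSet (B i) := fun i => hB i (mem_univ i)
  rw [Measure.map_apply hum ((MeasurableSet.pi s.countable_toSet fun i _ => hA' i).prod
    (MeasurableSet.pi t.countable_toSet fun i _ => hB' i))]
  have hpre : u ⁻¹' ((s : Set ι).pi A ×ˢ (t : Set ι).pi B) = ((s ∪ t : Finset ι) : Set ι).pi
      (fun i => (if i ∈ s then A i else univ) ×ˢ (if i ∈ t then B i else univ)) := by
    ext q
    simp only [u, mem_preimage, mem_prod, Set.mem_pi, Finset.coe_union, mem_union, Finset.mem_coe]
    constructor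
    · rintro ⟨h1, h2⟩ i -
      constructor
      · split_ifs with hi
        exacts [h1 i hi, mem_univ _]
      · split_ifs with hi
        exacts [h2 i hi, mem_univ _]
    · intro h
      refine ⟨fun i hi => ?_, fun i hi => ?_⟩
      · have := (h i (Or.inl hi)).1; rwa [if_pos hi] at this
      · have := (h i (Or.inr hi)).2; rwa [if_pos hi] at this
  rw [hpre, Measure.infinitePi_pi _ fun i _ => ?_, Measure.infinitePi_pi _ fun i _ => hA' i,
    Measure.infinitePi_pi _ fun i _ => hB' i]
  · simp only [Measure.prod_prod, Finset.prod_mul_distrib]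
    congr 1
    · rw [← Finset.prod_subset (Finset.subset_union_left (s₁ := s) (s₂ := t))]
      · exact Finset.prod_congr rfl fun i hi => by rw [if_pos hi]
      · intro i _ hi; rw [if_neg hi, measure_univ]
    · rw [← Finset.prod_subset (Finset.subset_union_right (s₁ := s) (s₂ := t))]
      · exact Finset.prod_congr rfl fun i hi => by rw [if_pos hi]
      · intro i _ hi; rw [if_neg hi, measure_univ]
  · refine MeasurableSet.prod ?_ ?_ <;> split_ifs
    exacts [hA' i, MeasurableSet.univ, hB' i, MeasurableSet.univ]

/-! ### Beta-gamma algebra -/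

/-- The densities in `gamma_prod_beta_map` agree after the substitution `τ = x + y`, `b = y / τ`,
the last factor being the Jacobian. Outside the open quadrant both sides vanish. -/
lemma betaGamma_density (a b γ x y : ℝ) (ha : 0 < a) (hb : 0 < b) (hγ : 0 < γ) (hx : x ≠ 0)
    (hy : y ≠ 0) (hxy : x + y ≠ 0) :
    betaPDF a b (y / (x + y)) * gammaPDF (a + b) γ (x + y) * (ENNReal.ofReal |x + y|)⁻¹
      = gammaPDF b γ x * gammaPDF a γ y := by
  rcases lt_or_gt_of_ne hxy with h | h
  · rw [gammaPDF_of_neg h]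
    rcases lt_or_ge x 0 with h1 | h1
    · simp [gammaPDF_of_neg h1]
    · simp [gammaPDF_of_neg (show y < 0 by linarith)]
  rcases lt_or_gt_of_ne hx with hx' | hx'
  · rw [betaPDF_eq_zero_of_one_le, gammaPDF_of_neg hx']
    · simp
    · rw [le_div_iff₀ h]; linarith
  rcases lt_or_gt_of_ne hy with hy' | hy'
  · rw [betaPDF_eq_zero_of_nonpos, gammaPDF_of_neg hy']
    · simp
    · exact (div_neg_of_neg_of_pos hy' h).le
  have e1 : 1 - y / (x + y) = x / (x + y) := by field_simp; ring
  rw [betaPDF_of_pos_lt_one (by positivity) (by rw [div_lt_one h]; linarith),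
    gammaPDF_of_nonneg h.le, gammaPDF_of_nonneg hx'.le, gammaPDF_of_nonneg hy'.le, abs_of_pos h,
    ← ENNReal.ofReal_inv_of_pos h,
    ← ENNReal.ofReal_mul (by rw [e1]; have := beta_pos ha hb; positivity),
    ← ENNReal.ofReal_mul (by rw [e1]; have := beta_pos ha hb; positivity),
    ← ENNReal.ofReal_mul (by positivity), e1]
  congr 1
  have g1 := (Real.Gamma_pos_of_pos ha).ne'
  have g2 := (Real.Gamma_pos_of_pos hb).ne'
  have g3 := (Real.Gamma_pos_of_pos (add_pos ha hb)).ne'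
  rw [beta, Real.div_rpow hy'.le h.le, Real.div_rpow hx'.le h.le, Real.rpow_add hγ,
    show a + b - 1 = (a - 1) + (b - 1) + 1 by ring, Real.rpow_add h, Real.rpow_add h, Real.rpow_one,
    show -(γ * (x + y)) = -(γ * x) + -(γ * y) by ring, Real.exp_add]
  have p1 := (Real.rpow_pos_of_pos h (a - 1)).ne'
  have p2 := (Real.rpow_pos_of_pos h (b - 1)).ne'
  field_simp

/-- Beta-gamma algebra: a gamma variable divided in an independent beta proportion with matching
parameters has independent gamma parts. -/
lemma gamma_prod_beta_map (a b γ : ℝ) (ha : 0 < a) (hb : 0 < b) (hγ : 0 < γ) :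
    ((gammaMeasure (a + b) γ).prod (betaMeasure a b)).map
      (fun p => ((1 - p.2) * p.1, p.2 * p.1))
      = (gammaMeasure b γ).prod (gammaMeasure a γ) := by
  have := isProbabilityMeasure_gammaMeasure (add_pos ha hb) hγ
  have := isProbabilityMeasure_gammaMeasure ha hγ
  have := isProbabilityMeasure_gammaMeasure hb hγ
  have := isProbabilityMeasureBeta ha hb
  have mg : ∀ c, Measurable (gammaPDF c γ) := fun c => by unfold gammaPDF; fun_prop
  have mb : Measurable (betaPDF a b) := by unfold betaPDF; fun_prop
  have hφ : Measurable (fun p : ℝ × ℝ => ((1 - p.2) * p.1, p.2 * p.1)) := by fun_prop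
  refine Measure.ext_of_lintegral _ fun f hf => ?_
  rw [lintegral_map hf hφ, lintegral_prod _ (by fun_prop), lintegral_prod _ (by fun_prop)]
  have hinner : ∀ (c : ℝ) (μ : Measure ℝ) [SFinite μ] (g : ℝ → ℝ → ℝ≥0∞),
      Measurable (Function.uncurry g) →
      ∫⁻ x, ∫⁻ y, g x y ∂μ ∂(gammaMeasure c γ) = ∫⁻ x, gammaPDF c γ x * ∫⁻ y, g x y ∂μ := by
    intro c μ _ g hg
    rw [gammaMeasure, lintegral_withDensity_eq_lintegral_mul _ (mg c) hg.lintegral_prod_right]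
    rfl
  rw [hinner _ _ (fun x y => f ((1 - y) * x, y * x)) (by fun_prop),
    hinner _ _ (fun x y => f (x, y)) (by fun_prop)]
  set K : ℝ → ℝ → ℝ≥0∞ := fun τ y =>
    f (τ - y, y) * (betaPDF a b (y / τ) * gammaPDF (a + b) γ τ * (ENNReal.ofReal |τ|)⁻¹) with hK
  have hKm : Measurable (Function.uncurry K) := by
    simp only [hK, Function.uncurry_def]; fun_prop
  -- For fixed `τ`, substitute `y = u τ`.
  have step1 : ∀ᵐ τ : ℝ, gammaPDF (a + b) γ τ * ∫⁻ u, f ((1 - u) * τ, u * τ) ∂(betaMeasure a b)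
      = ∫⁻ y, K τ y := by
    filter_upwards [Measure.ae_ne volume (0 : ℝ)] with τ hτ
    have hτ' : ENNReal.ofReal |τ| ≠ 0 := by simpa using hτ
    rw [betaMeasure, lintegral_withDensity_eq_lintegral_mul _ mb (by fun_prop),
      ← lintegral_const_mul _ (by fun_prop)]
    conv_rhs => rw [← Real.smul_map_volume_mul_left hτ]
    rw [lintegral_smul_measure, lintegral_map (by fun_prop) (by fun_prop), smul_eq_mul,
      ← lintegral_const_mul _ (by fun_prop)]
    refine lintegral_congr fun u => ?_
    simp only [hK, Pi.mul_apply]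
    rw [mul_div_cancel_left₀ _ hτ, show τ - τ * u = (1 - u) * τ by ring, mul_comm τ u]
    calc _ = gammaPDF (a + b) γ τ * (betaPDF a b u * f ((1 - u) * τ, u * τ)) * 1 := by rw [mul_one]
      _ = _ := by rw [← ENNReal.mul_inv_cancel hτ' ENNReal.ofReal_ne_top]; ring
  rw [lintegral_congr_ae step1, lintegral_lintegral_swap hKm.aemeasurable]
  have step2 : ∀ x, gammaPDF b γ x * ∫⁻ y, f (x, y) ∂(gammaMeasure a γ)
      = ∫⁻ y, f (x, y) * (gammaPDF b γ x * gammaPDF a γ y) := by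
    intro x
    rw [gammaMeasure, lintegral_withDensity_eq_lintegral_mul _ (mg a) (by fun_prop),
      ← lintegral_const_mul _ (by fun_prop)]
    refine lintegral_congr fun y => ?_
    simp only [Pi.mul_apply]; ring
  simp_rw [step2]
  conv_rhs => rw [lintegral_lintegral_swap (by fun_prop)]
  refine lintegral_congr_ae ?_
  filter_upwards [Measure.ae_ne volume (0 : ℝ)] with y hy
  -- For fixed `y`, substitute `τ = x + y`.
  rw [← lintegral_add_right_eq_self (fun τ => K τ y) y]
  refine lintegral_congr_ae ?_
  filter_upwards [Measure.ae_ne volume (0 : ℝ), Measure.ae_ne volume (-y)] with x hx hxy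
  simp only [hK, add_sub_cancel_right]
  rw [betaGamma_density a b γ x y ha hb hγ hx hy (fun h => hxy (by linarith))]

/-! ### Dividing intervals and exchanging their parts -/

/-- The law of the two parts `((1 - b) τ, b τ)` into which an interval of length `τ ∼ F` is
divided in the independent proportion `b ∼ G`. -/
noncomputable def pairLaw (F G : Measure ℝ) : Measure (ℝ × ℝ) :=
  (F.prod G).map fun p => ((1 - p.2) * p.1, p.2 * p.1)

/-- The law of the exchanged sequence for i.i.d. input of law `F` and i.i.d. proportions of
law `G`. -/
noncomputable def exchangeLaw (F G : Measure ℝ) [IsProbabilityMeasure F] [IsProbabilityMeasure G] :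
    Measure (ℤ → ℝ) :=
  ((Measure.infinitePi fun _ : ℤ => F).prod (Measure.infinitePi fun _ : ℤ => G)).map
    fun p => exchange p.2 p.1

lemma measurable_exchange :
    Measurable fun p : (ℤ → ℝ) × (ℤ → ℝ) => exchange p.2 p.1 := by
  unfold exchange; fun_prop

section
variable (F G : Measure ℝ)

instance [IsProbabilityMeasure F] [IsProbabilityMeasure G] :
    IsProbabilityMeasure (pairLaw F G) := by
  unfold pairLaw; exact Measure.isProbabilityMeasure_map (by fun_prop)

instance [IsProbabilityMeasure F] [IsProbabilityMeasure G] :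
    IsProbabilityMeasure (exchangeLaw F G) := by
  unfold exchangeLaw; exact Measure.isProbabilityMeasure_map measurable_exchange.aemeasurable

lemma pairLaw_map_add [IsProbabilityMeasure G] [SFinite F] :
    (pairLaw F G).map (fun p => p.1 + p.2) = F := by
  rw [pairLaw, Measure.map_map (by fun_prop) (by fun_prop)]
  have : ((fun p : ℝ × ℝ => p.1 + p.2) ∘ fun p : ℝ × ℝ => ((1 - p.2) * p.1, p.2 * p.1))
      = Prod.fst := by ext p; simp; ring
  rw [this, Measure.map_fst_prod, measure_univ, one_smul]

lemma pairLaw_map_div [IsProbabilityMeasure F] [IsProbabilityMeasure G] (hF : ∀ᵐ x ∂F, 0 < x) :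
    (pairLaw F G).map (fun p => p.2 / (p.1 + p.2)) = G := by
  rw [pairLaw, Measure.map_map (by fun_prop) (by fun_prop)]
  have hF' : ∀ᵐ p ∂(F.prod G), 0 < p.1 := Measure.quasiMeasurePreserving_fst.ae hF
  have : ((fun p : ℝ × ℝ => p.2 / (p.1 + p.2)) ∘ fun p : ℝ × ℝ => ((1 - p.2) * p.1, p.2 * p.1))
      =ᵐ[F.prod G] Prod.snd := by
    filter_upwards [hF'] with p hp
    simp only [Function.comp]
    rw [show (1 - p.2) * p.1 + p.2 * p.1 = p.1 by ring, mul_div_cancel_right₀ _ hp.ne']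
  rw [Measure.map_congr this, Measure.map_snd_prod, measure_univ, one_smul]

lemma pairLaw_nonneg [SFinite F] [SFinite G] (hF : ∀ᵐ x ∂F, 0 < x)
    (hG : ∀ᵐ x ∂G, x ∈ Icc (0 : ℝ) 1) :
    ∀ᵐ p ∂(pairLaw F G), 0 ≤ p.1 ∧ 0 ≤ p.2 := by
  rw [pairLaw, ae_map_iff (by fun_prop) (by measurability)]
  have hF' : ∀ᵐ p ∂(F.prod G), 0 < p.1 := Measure.quasiMeasurePreserving_fst.ae hF
  have hG' : ∀ᵐ p ∂(F.prod G), p.2 ∈ Icc (0 : ℝ) 1 := Measure.quasiMeasurePreserving_snd.ae hG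
  filter_upwards [hF', hG'] with p h1 h2
  exact ⟨mul_nonneg (by linarith [h2.2]) h1.le, mul_nonneg h2.1 h1.le⟩

lemma exchangeLaw_eq_map_pairs [IsProbabilityMeasure F] [IsProbabilityMeasure G] : exchangeLaw F G =
    (Measure.infinitePi fun _ : ℤ => pairLaw F G).map fun z k => (z k).1 + (z (k + 1)).2 := by
  unfold pairLaw
  rw [← Measure.infinitePi_map_pi (fun _ : ℤ => F.prod G)
    (f := fun _ p => ((1 - p.2) * p.1, p.2 * p.1)) (by fun_prop),
    ← infinitePi_prod_map_zip F G, Measure.map_map (by fun_prop) (by fun_prop),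
    Measure.map_map (by fun_prop) (by fun_prop), exchangeLaw]
  rfl

lemma infinitePi_map_shift (μ : Measure ℝ) [IsProbabilityMeasure μ] (n : ℤ) :
    (Measure.infinitePi fun _ : ℤ => μ).map (fun x k => x (n + k))
      = Measure.infinitePi fun _ : ℤ => μ :=
  Measure.map_infinitePi_infinitePi_of_inj (P := fun _ : ℤ => μ) (f := fun k => n + k)
    (add_right_injective n)

/-- If the two parts of an interval are independent, the parts `(1 - b_k) τ_k` and
`b_{k+1} τ_{k+1}` are independent throughout, and regrouping them preserves the law. -/
lemma exchangeLaw_eq_of_pairLaw_eq_prod [IsProbabilityMeasure F] [IsProbabilityMeasure G]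
    {μ ν : Measure ℝ} [IsProbabilityMeasure μ]
    [IsProbabilityMeasure ν] (h : pairLaw F G = μ.prod ν) :
    exchangeLaw F G = Measure.infinitePi fun _ : ℤ => F := by
  have hsum : F = (μ.prod ν).map (fun p => p.1 + p.2) := by rw [← h, pairLaw_map_add]
  set M := Measure.infinitePi fun _ : ℤ => μ
  set N := Measure.infinitePi fun _ : ℤ => ν with hN
  have hzip := infinitePi_prod_map_zip (ι := ℤ) μ ν
  have hshift : M.prod N = (M.prod N).map (Prod.map id (fun x k => x (1 + k))) := by
    rw [← Measure.map_prod_map _ _ (by fun_prop) (by fun_prop), Measure.map_id, hN,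
      infinitePi_map_shift]
  conv_rhs => rw [hsum]
  rw [← Measure.infinitePi_map_pi (fun _ : ℤ => μ.prod ν) (f := fun _ p => p.1 + p.2)
    (by fun_prop), ← hzip, Measure.map_map (by fun_prop) (by fun_prop), hshift,
    Measure.map_map (by fun_prop) (by fun_prop), exchangeLaw_eq_map_pairs]
  simp only [h]
  rw [← hzip, Measure.map_map (by fun_prop) (by fun_prop)]
  congr 1
  ext p k
  simp [add_comm]

lemma integrable_exp_neg_of_nonneg {α : Type*} [MeasurableSpace α] {P : Measure α}
    [IsFiniteMeasure P] {f : α → ℝ} (hf : Measurable f) (h : ∀ᵐ x ∂P, 0 ≤ f x) :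
    Integrable (fun x => Real.exp (-f x)) P := by
  refine Integrable.of_bound (by fun_prop) 1 ?_
  filter_upwards [h] with x hx
  rw [Real.norm_eq_abs, Real.abs_exp, Real.exp_le_one_iff]
  linarith

/-- Two consecutive entries of the exchanged sequence share only the interval `τ_{k+1}`.
If they are independent, dividing out the Laplace transforms of the unshared parts shows that
the two parts of an interval are independent. -/
lemma pairLaw_eq_prod_of_consecutive [IsProbabilityMeasure F] [IsProbabilityMeasure G]
    (hF : ∀ᵐ x ∂F, 0 < x) (hG : ∀ᵐ x ∂G, x ∈ Icc (0 : ℝ) 1)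
    (k : ℤ) (h : (exchangeLaw F G).map (fun x => (x k, x (k + 1))) = F.prod F) :
    pairLaw F G = (pairLaw F G).fst.prod (pairLaw F G).snd := by
  set J := pairLaw F G with hJ
  have hnn : ∀ᵐ p ∂J, 0 ≤ p.1 ∧ 0 ≤ p.2 := pairLaw_nonneg F G hF hG
  have hJF : J.map (fun p => p.1 + p.2) = F := pairLaw_map_add F G
  set LX : ℝ → ℝ := fun s => ∫ p, Real.exp (-(s * p.1)) ∂J with hLX
  set LY : ℝ → ℝ := fun s => ∫ p, Real.exp (-(s * p.2)) ∂J with hLY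
  set H : ℝ → ℝ → ℝ := fun s t => ∫ p, Real.exp (-(s * p.1 + t * p.2)) ∂J with hH
  set LF : ℝ → ℝ := fun s => ∫ x, Real.exp (-(s * x)) ∂F with hLF
  -- The exponent splits over the three pairs `k`, `k + 1`, `k + 2`.
  have main : ∀ s t, LX s * H t s * LY t = LF s * LF t := by
    intro s t
    have e1 : LF s * LF t = ∫ p, Real.exp (-(s * p.1)) * Real.exp (-(t * p.2)) ∂(F.prod F) :=
      (integral_prod_mul _ _).symm
    have hinj : Function.Injective (fun i : Fin 3 => k + (i : ℤ)) := by
      intro i j hij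
      simp only [add_right_inj, Nat.cast_inj] at hij
      exact Fin.ext (by exact_mod_cast hij)
    have e2 := Measure.map_infinitePi_infinitePi_of_inj (P := fun _ : ℤ => J) hinj
    rw [Measure.infinitePi_eq_pi (fun _ : Fin 3 => J)] at e2
    have e3 : exchangeLaw F G = _ := exchangeLaw_eq_map_pairs F G
    rw [e1, ← h, e3, Measure.map_map (by fun_prop) (by fun_prop),
      integral_map (by fun_prop) (by fun_prop)]
    set f : Fin 3 → ℝ × ℝ → ℝ := ![fun p => Real.exp (-(s * p.1)),
      fun p => Real.exp (-(t * p.1 + s * p.2)), fun p => Real.exp (-(t * p.2))] with hf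
    have hfm : ∀ i, Measurable (f i) := by
      intro i; fin_cases i <;> simp only [f] <;> dsimp <;> fun_prop
    have e4 := integral_fintype_prod_eq_prod (𝕜 := ℝ) (fun i : Fin 3 => f i) (μ := fun _ => J)
    rw [Fin.prod_univ_three] at e4
    change _ = LX s * H t s * LY t at e4
    rw [← e4, ← e2, integral_map
      (measurable_pi_lambda _ fun i => measurable_pi_apply _).aemeasurable (by
      refine Measurable.aestronglyMeasurable ?_
      exact Finset.measurable_fun_prod _ fun i _ => (hfm i).comp (measurable_pi_apply i))]
    refine integral_congr_ae (ae_of_all _ fun z => ?_)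
    simp only [Fin.prod_univ_three, f, Function.comp, ← Real.exp_add]
    simp only [Matrix.cons_val, ← Real.exp_add]
    congr 1
    norm_num [add_assoc]
    ring
  have hpos : ∀ f : ℝ × ℝ → ℝ, Measurable f → (∀ᵐ p ∂J, 0 ≤ f p) →
      0 < ∫ p, Real.exp (-f p) ∂J := fun f hf h0 =>
    integral_exp_pos (integrable_exp_neg_of_nonneg hf h0)
  have hX : ∀ s, 0 ≤ s → 0 < LX s := fun s hs => hpos _ (by fun_prop) (by
    filter_upwards [hnn] with p hp; exact mul_nonneg hs hp.1)
  have hY : ∀ s, 0 ≤ s → 0 < LY s := fun s hs => hpos _ (by fun_prop) (by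
    filter_upwards [hnn] with p hp; exact mul_nonneg hs hp.2)
  have hLFeq : ∀ s, LF s = LX s * LY s := by
    intro s
    have := main s 0
    simp only [hH, hLY, hLF, zero_mul, neg_zero, Real.exp_zero, zero_add] at this
    simpa using this.symm
  refine ext_of_laplace hnn ?_ fun s t hs ht => ?_
  · have h1 : ∀ᵐ x ∂J.fst, 0 ≤ x := by
      rw [Measure.fst, ae_map_iff (by fun_prop) measurableSet_Ici]
      exact hnn.mono fun p hp => hp.1
    have h2 : ∀ᵐ x ∂J.snd, 0 ≤ x := by
      rw [Measure.snd, ae_map_iff (by fun_prop) measurableSet_Ici]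
      exact hnn.mono fun p hp => hp.2
    exact (Measure.quasiMeasurePreserving_fst.ae h1).and (Measure.quasiMeasurePreserving_snd.ae h2)
  · have m := main t s
    rw [hLFeq, hLFeq] at m
    have : H s t = LX s * LY t := by
      have := (hX t ht).ne'
      have := (hY s hs).ne'
      have e : (LX t * LY s) * H s t = (LX t * LY s) * (LX s * LY t) := by linarith
      exact mul_left_cancel₀ (by positivity) e
    change H s t = _
    rw [this]
    simp only [neg_add, Real.exp_add]
    rw [integral_prod_mul (fun x => Real.exp (-(s * x))) (fun y => Real.exp (-(t * y))),
      Measure.fst, Measure.snd, integral_map (by fun_prop) (by fun_prop),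
      integral_map (by fun_prop) (by fun_prop)]

end

/-! ### Laplace transforms on the negative half-line -/

lemma pairLaw_dirac_dirac (s b : ℝ) :
    pairLaw (Measure.dirac s) (Measure.dirac b) = Measure.dirac ((1 - b) * s, b * s) := by
  rw [pairLaw, Measure.dirac_prod_dirac, Measure.map_dirac' (by fun_prop)]

lemma gammaMeasure_ae_pos (a γ : ℝ) : ∀ᵐ x ∂(gammaMeasure a γ), 0 < x := by
  have mg : Measurable (gammaPDF a γ) := by unfold gammaPDF; fun_prop
  rw [gammaMeasure, ae_withDensity_iff mg]
  filter_upwards [Measure.ae_ne volume (0 : ℝ)] with x hx h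
  by_contra hc
  exact h (gammaPDF_of_neg (lt_of_le_of_ne (not_lt.1 hc) hx))

/-- The Laplace transform of the gamma distribution. -/
lemma integral_exp_neg_gammaMeasure {a γ : ℝ} (ha : 0 < a) (hγ : 0 < γ) {s : ℝ} (hs : 0 ≤ s) :
    ∫ x, Real.exp (-(s * x)) ∂(gammaMeasure a γ) = (1 + s / γ) ^ (-a) := by
  have mg : Measurable (gammaPDF a γ) := by unfold gammaPDF; fun_prop
  rw [gammaMeasure, integral_withDensity_eq_integral_toReal_smul mg
    (ae_of_all _ fun x => ENNReal.ofReal_lt_top),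
    ← setIntegral_eq_integral_of_ae_compl_eq_zero (s := Ioi 0)]
  · have : EqOn (fun x => (gammaPDF a γ x).toReal • Real.exp (-(s * x)))
        (fun x => γ ^ a / Real.Gamma a * (x ^ (a - 1) * Real.exp (-((γ + s) * x)))) (Ioi 0) := by
      intro x (hx : 0 < x)
      have := Real.Gamma_pos_of_pos ha
      simp only [gammaPDF_of_nonneg hx.le, smul_eq_mul]
      rw [ENNReal.toReal_ofReal (by positivity), show -((γ + s) * x) = -(γ * x) + -(s * x) by ring,
        Real.exp_add]
      ring
    rw [setIntegral_congr_fun measurableSet_Ioi this, integral_const_mul,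
      Real.integral_rpow_mul_exp_neg_mul_Ioi ha (by positivity)]
    have hG := (Real.Gamma_pos_of_pos ha).ne'
    rw [show 1 + s / γ = (γ + s) / γ by field_simp, Real.rpow_neg (by positivity),
      Real.div_rpow (by positivity) hγ.le, Real.div_rpow zero_le_one (by positivity), Real.one_rpow]
    field_simp
  · filter_upwards [Measure.ae_ne volume (0 : ℝ)] with x hx hx'
    have : x < 0 := lt_of_le_of_ne (not_lt.1 hx') hx
    simp [gammaPDF_of_neg this]

lemma eq_dirac_of_ae_eq {G : Measure ℝ} [IsProbabilityMeasure G] {c : ℝ} (h : ∀ᵐ x ∂G, x = c) :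
    G = Measure.dirac c := by
  have : G.map id = G.map (fun _ => c) := Measure.map_congr h
  rwa [Measure.map_id, Measure.map_const, measure_univ, one_smul] at this

lemma mem_interior_integrableExpSet_of_nonneg {μ : Measure ℝ} [IsProbabilityMeasure μ]
    (hμ : ∀ᵐ x ∂μ, 0 ≤ x) {t : ℝ} (ht : t < 0) :
    t ∈ interior (integrableExpSet (fun x : ℝ => x) μ) := by
  refine interior_maximal (t := Iio 0) (fun u (hu : u < 0) => ?_) isOpen_Iio ht
  have := integrable_exp_neg_of_nonneg (P := μ) (f := fun x => -u * x) (by fun_prop)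
    (hμ.mono fun x hx => mul_nonneg (by linarith) hx)
  simpa [integrableExpSet] using this

lemma tendsto_integral_exp_zero {μ : Measure ℝ} [IsProbabilityMeasure μ]
    (hμ : ∀ᵐ x ∂μ, 0 ≤ x) :
    Tendsto (fun t => ∫ x, Real.exp (t * x) ∂μ) (𝓝[<] 0) (𝓝 1) := by
  have : (1 : ℝ) = ∫ x, (1 : ℝ) ∂μ := by simp
  rw [this]
  refine tendsto_integral_filter_of_dominated_convergence (fun _ => 1)
    (Eventually.of_forall fun t => by fun_prop) ?_ (by simp) ?_
  · filter_upwards [self_mem_nhdsWithin] with t (ht : t < 0)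
    filter_upwards [hμ] with x hx
    rw [Real.norm_eq_abs, Real.abs_exp, Real.exp_le_one_iff]
    nlinarith
  · refine ae_of_all _ fun x => ?_
    have : Continuous fun t : ℝ => Real.exp (t * x) := by fun_prop
    have h := (this.tendsto 0).mono_left (nhdsWithin_le_nhds (s := Iio 0))
    simpa using h

lemma const_on_Iio_of_hasDerivAt_zero {ψ : ℝ → ℝ} (h : ∀ t < 0, HasDerivAt ψ 0 t) {s t : ℝ}
    (hs : s < 0) (ht : t < 0) : ψ s = ψ t :=
  isOpen_Iio.is_const_of_deriv_eq_zero isPreconnected_Iio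
    (fun u hu => (h u hu).differentiableAt.differentiableWithinAt)
    (fun u hu => (h u hu).deriv) hs ht

lemma eq_of_hasDerivAt_zero_of_tendsto {ψ : ℝ → ℝ} {K : ℝ} (h : ∀ t < 0, HasDerivAt ψ 0 t)
    (hK : Tendsto ψ (𝓝[<] 0) (𝓝 K)) {t : ℝ} (ht : t < 0) : ψ t = K := by
  refine tendsto_nhds_unique (tendsto_const_nhds.congr' ?_) hK
  filter_upwards [self_mem_nhdsWithin] with s hs
  exact const_on_Iio_of_hasDerivAt_zero h ht hs

/-- Solution of `φ' = p φ / (c - κ t)` on the negative half-line with `φ(0-) = 1`. -/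
lemma eq_rpow_of_ode {φ φ' : ℝ → ℝ} {c κ p : ℝ} (hκ : 0 < κ) (hp : 0 < p)
    (hpos : ∀ t < 0, 0 < φ t) (hc : ∀ t < 0, 0 < c - κ * t)
    (hd : ∀ t < 0, HasDerivAt φ (φ' t) t) (he : ∀ t < 0, φ' t * (c - κ * t) = p * φ t)
    (hlim : Tendsto φ (𝓝[<] 0) (𝓝 1)) :
    0 < c ∧ ∀ t < 0, φ t = (1 - κ * t / c) ^ (-(p / κ)) := by
  have hpk : 0 < p / κ := by positivity
  have hψ : ∀ t < 0, HasDerivAt (fun t => φ t * (c - κ * t) ^ (p / κ)) 0 t := by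
    intro t ht
    have h1 : HasDerivAt (fun t => c - κ * t) (-κ) t := by
      simpa using ((hasDerivAt_id t).const_mul κ).const_sub c
    have h2 := (hd t ht).mul (h1.rpow_const (p := p / κ) (Or.inl (hc t ht).ne'))
    refine h2.congr_deriv ?_
    have e : (c - κ * t) ^ (p / κ) = (c - κ * t) ^ (p / κ - 1) * (c - κ * t) := by
      rw [← Real.rpow_add_one (hc t ht).ne']; congr 1; ring
    rw [e]
    have e2 : κ * (p / κ) = p := mul_div_cancel₀ _ hκ.ne'
    linear_combination (c - κ * t) ^ (p / κ - 1) * he t ht - φ t * (c - κ * t) ^ (p / κ - 1) * e2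
  have hlim2 : Tendsto (fun t => φ t * (c - κ * t) ^ (p / κ)) (𝓝[<] 0) (𝓝 (c ^ (p / κ))) := by
    have h1 : Tendsto (fun t : ℝ => c - κ * t) (𝓝[<] 0) (𝓝 c) := by
      have : Continuous fun t : ℝ => c - κ * t := by fun_prop
      simpa using (this.tendsto 0).mono_left (nhdsWithin_le_nhds (s := Iio 0))
    simpa using hlim.mul (h1.rpow_const (p := p / κ) (Or.inr hpk.le))
  have hval := fun t (ht : t < 0) => eq_of_hasDerivAt_zero_of_tendsto hψ hlim2 ht
  have hc0 : 0 ≤ c := by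
    by_contra hneg
    have := hc (c / κ) (div_neg_of_neg_of_pos (not_le.1 hneg) hκ)
    rw [mul_div_cancel₀ _ hκ.ne'] at this
    simp at this
  -- If `c = 0`, the constant `c ^ (p / κ)` vanishes, contradicting positivity.
  have hcpos : 0 < c := by
    rcases hc0.eq_or_lt with h0 | h0
    · exfalso
      have h1 := hval (-1) (by norm_num)
      rw [← h0, Real.zero_rpow hpk.ne'] at h1
      have := mul_pos (hpos (-1) (by norm_num))
        (Real.rpow_pos_of_pos (hc (-1) (by norm_num)) (p / κ))
      rw [← h0] at this
      linarith
    · exact h0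
  refine ⟨hcpos, fun t ht => ?_⟩
  have h1 := hval t ht
  have h2 := Real.rpow_pos_of_pos (hc t ht) (p / κ)
  rw [show 1 - κ * t / c = (c - κ * t) / c by field_simp, Real.rpow_neg (by
    have := hc t ht; positivity), Real.div_rpow (hc t ht).le hc0, inv_div, ← h1]
  field_simp

/-- Solution of `φ' = p φ` on the negative half-line with `φ(0-) = 1`. -/
lemma eq_exp_of_ode {φ φ' : ℝ → ℝ} {p : ℝ}
    (hd : ∀ t < 0, HasDerivAt φ (φ' t) t) (he : ∀ t < 0, φ' t = p * φ t)
    (hlim : Tendsto φ (𝓝[<] 0) (𝓝 1)) {t : ℝ} (ht : t < 0) : φ t = Real.exp (p * t) := by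
  have hψ : ∀ t < 0, HasDerivAt (fun t => φ t * Real.exp (-(p * t))) 0 t := by
    intro t ht
    have h1 : HasDerivAt (fun t => -(p * t)) (-p) t := by
      simpa using (hasDerivAt_id t).const_mul (-p)
    refine ((hd t ht).mul h1.exp).congr_deriv ?_
    rw [he t ht]; ring
  have hlim2 : Tendsto (fun t => φ t * Real.exp (-(p * t))) (𝓝[<] 0) (𝓝 1) := by
    have : Continuous fun t : ℝ => Real.exp (-(p * t)) := by fun_prop
    simpa using hlim.mul ((this.tendsto 0).mono_left (nhdsWithin_le_nhds (s := Iio 0)))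
  have h := eq_of_hasDerivAt_zero_of_tendsto hψ hlim2 ht
  rw [Real.exp_neg] at h
  have := (Real.exp_pos (p * t)).ne'
  field_simp at h
  exact h

/-! ### Lukacs' theorem -/

section
variable {F G : Measure ℝ} [IsProbabilityMeasure F] [IsProbabilityMeasure G]

/-- The law of the two parts determines the law of the length and that of the proportion. -/
lemma pairLaw_injective {F' G' : Measure ℝ} [IsProbabilityMeasure F'] [IsProbabilityMeasure G']
    (hF : ∀ᵐ x ∂F, 0 < x) (hF' : ∀ᵐ x ∂F', 0 < x) (h : pairLaw F G = pairLaw F' G') :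
    F = F' ∧ G = G' := by
  constructor
  · rw [← pairLaw_map_add F G, h, pairLaw_map_add]
  · rw [← pairLaw_map_div F G hF, h, pairLaw_map_div F' G' hF']

lemma eq_dirac_of_laplace_pairLaw (hF : ∀ᵐ x ∂F, 0 < x) (hG : ∀ᵐ x ∂G, x ∈ Icc (0 : ℝ) 1)
    {c m : ℝ} (hc : 0 < c) (hm : 0 ≤ m) (hm1 : m ≤ 1)
    (h : ∀ s t : ℝ, 0 ≤ s → 0 ≤ t → ∫ p, Real.exp (-(s * p.1 + t * p.2)) ∂(pairLaw F G)
      = Real.exp (-((1 - m) / c * s)) * Real.exp (-(m / c * t))) :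
    F = Measure.dirac (1 / c) ∧ G = Measure.dirac m := by
  refine pairLaw_injective hF (by rw [ae_dirac_iff measurableSet_Ioi]; positivity) ?_
  have hm2 := sub_nonneg.2 hm1
  rw [pairLaw_dirac_dirac]
  refine ext_of_laplace (pairLaw_nonneg F G hF hG) ?_ fun s t hs ht => ?_
  · rw [ae_dirac_iff (by measurability)]
    constructor <;> positivity
  · rw [h s t hs ht, integral_dirac, ← Real.exp_add]
    congr 1; ring

lemma eq_gamma_of_laplace_pairLaw (hF : ∀ᵐ x ∂F, 0 < x) (hG : ∀ᵐ x ∂G, x ∈ Icc (0 : ℝ) 1)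
    {a b γ : ℝ} (ha : 0 < a) (hb : 0 < b) (hγ : 0 < γ)
    (h : ∀ s t : ℝ, 0 ≤ s → 0 ≤ t → ∫ p, Real.exp (-(s * p.1 + t * p.2)) ∂(pairLaw F G)
      = (1 + s / γ) ^ (-b) * (1 + t / γ) ^ (-a)) :
    F = gammaMeasure (a + b) γ ∧ G = betaMeasure a b := by
  have := isProbabilityMeasure_gammaMeasure (add_pos ha hb) hγ
  have := isProbabilityMeasure_gammaMeasure ha hγ
  have := isProbabilityMeasure_gammaMeasure hb hγ
  have := isProbabilityMeasureBeta ha hb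
  refine pairLaw_injective hF (gammaMeasure_ae_pos _ _) ?_
  have e : pairLaw (gammaMeasure (a + b) γ) (betaMeasure a b) = _ :=
    gamma_prod_beta_map a b γ ha hb hγ
  rw [e]
  refine ext_of_laplace (pairLaw_nonneg F G hF hG) ?_ fun s t hs ht => ?_
  · exact (Measure.quasiMeasurePreserving_fst.ae
      ((gammaMeasure_ae_pos b γ).mono fun x hx => hx.le)).and
      (Measure.quasiMeasurePreserving_snd.ae ((gammaMeasure_ae_pos a γ).mono fun x hx => hx.le))
  · rw [h s t hs ht]
    simp only [neg_add, Real.exp_add]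
    rw [integral_prod_mul (fun x => Real.exp (-(s * x))) (fun y => Real.exp (-(t * y))),
      integral_exp_neg_gammaMeasure hb hγ hs, integral_exp_neg_gammaMeasure ha hγ ht]

/-- If the parts of an interval are independent, the moments of the right part, weighted with an
exponential of the whole length, factor in two ways. -/
lemma integral_pow_mul_exp_factor {μ ν : Measure ℝ} [IsProbabilityMeasure μ]
    [IsProbabilityMeasure ν] (h : pairLaw F G = μ.prod ν) (n : ℕ) (t : ℝ) :
    (∫ y, y ^ n * Real.exp (t * y) ∂ν) * ∫ x, Real.exp (t * x) ∂μ
      = (∫ b, b ^ n ∂G) * ∫ x, x ^ n * Real.exp (t * x) ∂F := by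
  have h1 : ∫ p, p.2 ^ n * Real.exp (t * (p.1 + p.2)) ∂(μ.prod ν)
      = (∫ x, Real.exp (t * x) ∂μ) * ∫ y, y ^ n * Real.exp (t * y) ∂ν := by
    rw [← integral_prod_mul]
    refine integral_congr_ae (ae_of_all _ fun p => ?_)
    simp only [mul_add, Real.exp_add]; ring
  have h2 : ∫ p, p.2 ^ n * Real.exp (t * (p.1 + p.2)) ∂(pairLaw F G)
      = (∫ x, x ^ n * Real.exp (t * x) ∂F) * ∫ b, b ^ n ∂G := by
    rw [← integral_prod_mul, pairLaw, integral_map (by fun_prop) (by fun_prop)]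
    refine integral_congr_ae (ae_of_all _ fun p => ?_)
    simp only [mul_pow]
    rw [show (1 - p.2) * p.1 + p.2 * p.1 = p.1 by ring]; ring
  rw [mul_comm, ← h1, ← h, h2, mul_comm]

/-- Lukacs' theorem: if an interval of length `τ ∼ F`, divided in an independent proportion
`b ∼ G`, has independent parts, then one of the alternatives holds. -/
lemma fixedPointAlternatives_of_pairLaw_eq_prod (hF : ∀ᵐ x ∂F, 0 < x)
    (hG : ∀ᵐ x ∂G, x ∈ Icc (0 : ℝ) 1) {μ ν : Measure ℝ} [IsProbabilityMeasure μ]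
    [IsProbabilityMeasure ν] (hJ : pairLaw F G = μ.prod ν) : FixedPointAlternatives F G := by
  have hnn := pairLaw_nonneg F G hF hG
  have hμ : ∀ᵐ x ∂μ, 0 ≤ x := by
    have : μ = (pairLaw F G).fst := by rw [hJ, Measure.fst_prod]
    rw [this, Measure.fst, ae_map_iff (by fun_prop) measurableSet_Ici]
    exact hnn.mono fun p hp => hp.1
  have hν : ∀ᵐ x ∂ν, 0 ≤ x := by
    have : ν = (pairLaw F G).snd := by rw [hJ, Measure.snd_prod]
    rw [this, Measure.snd, ae_map_iff (by fun_prop) measurableSet_Ici]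
    exact hnn.mono fun p hp => hp.2
  have hF0 : ∀ᵐ x ∂F, 0 ≤ x := hF.mono fun x hx => hx.le
  set f : ℝ → ℝ := fun t => ∫ x, Real.exp (t * x) ∂μ with hf
  set g : ℕ → ℝ → ℝ := fun n t => ∫ x, x ^ n * Real.exp (t * x) ∂ν with hg
  set h : ℕ → ℝ → ℝ := fun n t => ∫ x, x ^ n * Real.exp (t * x) ∂F with hh
  set m : ℕ → ℝ := fun n => ∫ b, b ^ n ∂G with hm
  have key : ∀ n t, g n t * f t = m n * h n t := integral_pow_mul_exp_factor hJ
  have hm0 : m 0 = 1 := by simp [hm]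
  have key0 : ∀ t, g 0 t * f t = h 0 t := fun t => by rw [key, hm0, one_mul]
  have hgd : ∀ n, ∀ t < 0, HasDerivAt (g n) (g (n + 1) t) t := fun n t ht =>
    hasDerivAt_integral_pow_mul_exp_real (mem_interior_integrableExpSet_of_nonneg hν ht) n
  have hhd : ∀ n, ∀ t < 0, HasDerivAt (h n) (h (n + 1) t) t := fun n t ht =>
    hasDerivAt_integral_pow_mul_exp_real (mem_interior_integrableExpSet_of_nonneg hF0 ht) n
  have hfpos : ∀ t ≤ 0, 0 < f t := fun t ht => by
    have := integrable_exp_neg_of_nonneg (P := μ) (f := fun x => -t * x) (by fun_prop)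
      (hμ.mono fun x hx => mul_nonneg (by linarith) hx)
    simp only [neg_mul, neg_neg] at this
    exact integral_exp_pos this
  have hhpos : ∀ n, ∀ t < 0, 0 < h n t := fun n t ht => by
    have hint : Integrable (fun x => x ^ n * Real.exp (t * x)) F :=
      integrable_pow_mul_exp_of_mem_interior_integrableExpSet
        (mem_interior_integrableExpSet_of_nonneg hF0 ht) n
    have hpos : ∀ᵐ x ∂F, 0 < x ^ n * Real.exp (t * x) := hF.mono fun x hx => by positivity
    refine (integral_pos_iff_support_of_nonneg_ae (hpos.mono fun x hx => hx.le) hint).2 ?_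
    have hs : ∀ᵐ x ∂F, x ∈ Function.support fun x => x ^ n * Real.exp (t * x) :=
      hpos.mono fun x hx => hx.ne'
    have e : F (Function.support fun x => x ^ n * Real.exp (t * x)) = 1 :=
      (measure_congr (eventuallyEq_univ.2 hs)).trans measure_univ
    rw [e]
    exact one_pos
  have hgpos : ∀ t < 0, 0 < g 0 t := fun t ht => by
    have h1 := hhpos 0 t ht
    rw [← key0] at h1
    exact (pos_iff_pos_of_mul_pos h1).2 (hfpos t ht.le)
  have r1 : ∀ t < 0, g 1 t * h 0 t = m 1 * h 1 t * g 0 t := fun t _ => by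
    rw [← key0, ← key]; ring
  have r2 : ∀ t < 0, g 2 t * h 0 t = m 2 * h 2 t * g 0 t := fun t _ => by
    rw [← key0, ← key]; ring
  -- Differentiating `r1` and eliminating the transforms of the right part.
  have r3 : ∀ t < 0, (m 1 - m 2) * (h 2 t * h 0 t) = (m 1 - m 1 ^ 2) * h 1 t ^ 2 := by
    intro t ht
    have d1 := (hgd 1 t ht).mul (hhd 0 t ht)
    have d2 := ((hhd 1 t ht).const_mul (m 1)).mul (hgd 0 t ht)
    have heq : (g 1 * h 0) =ᶠ[𝓝 t] ((fun t => m 1 * h 1 t) * g 0) := by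
      filter_upwards [isOpen_Iio.mem_nhds ht] with s hs using r1 s hs
    have d3 := (d2.congr_of_eventuallyEq heq).unique d1
    norm_num at d3
    have e1 := r1 t ht
    have e2 := r2 t ht
    have hg0 := (hgpos t ht).ne'
    have : g 0 t * ((m 1 - m 2) * (h 2 t * h 0 t)) = g 0 t * ((m 1 - m 1 ^ 2) * h 1 t ^ 2) := by
      linear_combination (h 0 t) * d3 + (h 1 t - m 1 * h 1 t) * e1 + h 0 t * e2
    exact mul_left_cancel₀ hg0 this
  have hbdd : ∀ n, Integrable (fun b : ℝ => b ^ n) G := fun n => by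
    refine Integrable.of_bound (by fun_prop) 1 ?_
    filter_upwards [hG] with b hb
    rw [Real.norm_eq_abs, abs_of_nonneg (pow_nonneg hb.1 n)]
    exact pow_le_one₀ hb.1 hb.2
  have hb1 : Integrable (fun b : ℝ => b) G := by simpa using hbdd 1
  have em1 : m 1 = ∫ b, b ∂G := by simp [hm]
  have hA : m 1 - m 2 = ∫ b, b * (1 - b) ∂G := by
    rw [em1, hm, ← integral_sub hb1 (hbdd 2)]
    exact integral_congr_ae (ae_of_all _ fun b => by ring)
  have hA0 : 0 ≤ m 1 - m 2 := by
    rw [hA]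
    exact integral_nonneg_of_ae (hG.mono fun b hb => mul_nonneg hb.1 (by linarith [hb.2]))
  have hV : m 2 - m 1 ^ 2 = ∫ b, (b - m 1) ^ 2 ∂G := by
    have : ∀ b : ℝ, (b - m 1) ^ 2 = b ^ 2 - 2 * m 1 * b + m 1 ^ 2 := fun b => by ring
    simp_rw [this]
    have i1 : Integrable (fun b => b ^ 2 - 2 * m 1 * b) G := (hbdd 2).sub (hb1.const_mul _)
    rw [integral_add i1 (integrable_const _), integral_sub (hbdd 2) (hb1.const_mul _),
      integral_const_mul, ← em1]
    simp [hm]; ring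
  have hV0 : 0 ≤ m 2 - m 1 ^ 2 := by rw [hV]; exact integral_nonneg fun b => sq_nonneg _
  rcases hA0.eq_or_lt with hA1 | hA1
  · -- The proportion takes only the values `0` and `1`, and its variance vanishes.
    right; right
    have h1 := r3 (-1) (by norm_num)
    rw [← hA1, zero_mul] at h1
    have h2 := hhpos 1 (-1) (by norm_num)
    have h3 : m 1 * (1 - m 1) = 0 := by
      have : m 1 - m 1 ^ 2 = 0 := by
        rcases mul_eq_zero.1 h1.symm with h | h
        · exact h
        · exact absurd h (by positivity)
      linarith
    rcases mul_eq_zero.1 h3 with h4 | h4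
    · left
      rw [em1, integral_eq_zero_iff_of_nonneg_ae (hG.mono fun b hb => hb.1) hb1] at h4
      exact eq_dirac_of_ae_eq h4
    · right
      have h5 : ∫ b, (1 - b) ∂G = 0 := by
        rw [integral_sub (integrable_const _) hb1, ← em1]; simpa using h4
      rw [integral_eq_zero_iff_of_nonneg_ae (hG.mono fun b hb => sub_nonneg.2 hb.2)
        ((integrable_const _).sub hb1)] at h5
      refine eq_dirac_of_ae_eq (h5.mono fun b hb => ?_)
      simp only [Pi.zero_apply] at hb
      linarith
  set κ : ℝ := (m 2 - m 1 ^ 2) / (m 1 - m 2) with hκ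
  have hκ0 : 0 ≤ κ := div_nonneg hV0 hA0
  have hm1 : 0 < m 1 * (1 - m 1) := by nlinarith
  have hm1nn : 0 ≤ m 1 := by
    rw [em1]; exact integral_nonneg_of_ae (hG.mono fun b hb => hb.1)
  have hmpos : 0 < m 1 := lt_of_le_of_ne hm1nn fun h0 => by rw [← h0] at hm1; simp at hm1
  have hmlt : 0 < 1 - m 1 := (pos_iff_pos_of_mul_pos hm1).1 hmpos
  -- The quotient of the transform and its derivative is affine.
  set c : ℝ := h 0 (-1) / h 1 (-1) - κ with hc
  have hq : ∀ t < 0, h 0 t / h 1 t = c - κ * t := by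
    have hder : ∀ t < 0, HasDerivAt (fun t => h 0 t / h 1 t + κ * t) 0 t := by
      intro t ht
      have hp := (hhpos 1 t ht).ne'
      have d := ((hhd 0 t ht).div (hhd 1 t ht) hp).add ((hasDerivAt_id t).const_mul κ)
      refine d.congr_deriv ?_
      have e := r3 t ht
      norm_num
      rw [hκ]
      field_simp
      linear_combination -e
    intro t ht
    have := const_on_Iio_of_hasDerivAt_zero hder ht (show (-1 : ℝ) < 0 by norm_num)
    rw [hc]; linarith
  have hcpos : ∀ t < 0, 0 < c - κ * t := fun t ht => by
    rw [← hq t ht]; exact div_pos (hhpos 0 t ht) (hhpos 1 t ht)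
  have odeh : ∀ t < 0, h 1 t * (c - κ * t) = 1 * h 0 t := fun t ht => by
    have := (hhpos 1 t ht).ne'
    rw [← hq t ht]; field_simp
  have odeg : ∀ t < 0, g 1 t * (c - κ * t) = m 1 * g 0 t := fun t ht => by
    have := (hhpos 1 t ht).ne'
    have e := r1 t ht
    rw [← hq t ht]; field_simp; linarith
  have limg : Tendsto (g 0) (𝓝[<] 0) (𝓝 1) := by
    simpa [hg] using tendsto_integral_exp_zero hν
  have limh : Tendsto (h 0) (𝓝[<] 0) (𝓝 1) := by
    simpa [hh] using tendsto_integral_exp_zero hF0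
  have hf0 : f 0 = 1 := by simp [hf]
  have hg0 : g 0 0 = 1 := by simp [hg]
  have laplaceJ : ∀ s t, ∫ p, Real.exp (-(s * p.1 + t * p.2)) ∂(pairLaw F G)
      = f (-s) * g 0 (-t) := by
    intro s t
    rw [hJ]
    simp only [neg_add, Real.exp_add, hf, hg, pow_zero, one_mul]
    rw [← integral_prod_mul]
    simp
  rcases hκ0.eq_or_lt with hκ1 | hκ1
  · -- Vanishing variance of `b`: the transforms are exponentials.
    right; left
    rw [← hκ1] at hq odeh odeg
    have hc0 : 0 < c := by have := hcpos (-1) (by norm_num); rw [← hκ1] at this; simpa using this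
    have sg : ∀ t ≤ 0, g 0 t = Real.exp (m 1 / c * t) := by
      intro t ht
      rcases ht.eq_or_lt with rfl | ht
      · simp [hg0]
      · refine eq_exp_of_ode (hgd 0) (fun t ht => ?_) limg ht
        have := odeg t ht
        norm_num at this ⊢
        field_simp; linarith
    have sh : ∀ t < 0, h 0 t = Real.exp (1 / c * t) := fun t ht =>
      eq_exp_of_ode (hhd 0) (fun t ht => by
        have := odeh t ht
        norm_num at this ⊢
        field_simp; linarith) limh ht
    have sf : ∀ t ≤ 0, f t = Real.exp ((1 - m 1) / c * t) := by
      intro t ht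
      rcases ht.eq_or_lt with rfl | ht
      · simp [hf0]
      · have e := key0 t
        rw [sg t ht.le, sh t ht, show 1 / c * t = m 1 / c * t + (1 - m 1) / c * t by ring,
          Real.exp_add] at e
        exact mul_left_cancel₀ (Real.exp_pos _).ne' e
    have hinj := eq_dirac_of_laplace_pairLaw hF hG hc0 hm1nn (by linarith) fun s t hs ht => by
      rw [laplaceJ, sf _ (by linarith), sg _ (by linarith), mul_neg, mul_neg]
    exact ⟨1 / c, m 1, by positivity, hm1nn, by linarith, hinj.1, hinj.2⟩
  · -- Nondegenerate `b`: the transforms are those of gamma distributions.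
    left
    obtain ⟨hc0, sg'⟩ := eq_rpow_of_ode hκ1 hmpos hgpos hcpos (hgd 0) odeg limg
    obtain ⟨-, sh⟩ := eq_rpow_of_ode hκ1 one_pos (hhpos 0) hcpos (hhd 0) odeh limh
    have hbase : ∀ t ≤ 0, 0 < 1 - κ * t / c := fun t ht => by
      have : κ * t / c ≤ 0 := div_nonpos_of_nonpos_of_nonneg
        (mul_nonpos_of_nonneg_of_nonpos hκ1.le ht) hc0.le
      linarith
    have sg : ∀ t ≤ 0, g 0 t = (1 - κ * t / c) ^ (-(m 1 / κ)) := by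
      intro t ht
      rcases ht.eq_or_lt with rfl | ht
      · simp [hg0]
      · exact sg' t ht
    have sf : ∀ t ≤ 0, f t = (1 - κ * t / c) ^ (-((1 - m 1) / κ)) := by
      intro t ht
      rcases ht.eq_or_lt with rfl | ht
      · simp [hf0]
      · have e := key0 t
        rw [sg t ht.le, sh t ht, show -(1 / κ) = -(m 1 / κ) + -((1 - m 1) / κ) by ring,
          Real.rpow_add (hbase t ht.le)] at e
        exact mul_left_cancel₀ (Real.rpow_pos_of_pos (hbase t ht.le) _).ne' e
    set γ := c / κ with hγ
    have hγ0 : 0 < γ := by positivity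
    set a := m 1 * (1 / κ) with ha
    set b := (1 - m 1) * (1 / κ) with hb
    have ha0 : 0 < a := by positivity
    have hb0 : 0 < b := by positivity
    have hab : a + b = 1 / κ := by rw [ha, hb]; ring
    have e : ∀ u : ℝ, 1 - κ * -u / c = 1 + u / γ := fun u => by rw [hγ]; field_simp; ring
    have hinj := eq_gamma_of_laplace_pairLaw hF hG ha0 hb0 hγ0 fun s t hs ht => by
      rw [laplaceJ, sf _ (by linarith), sg _ (by linarith), e, e, ha, hb, mul_one_div, mul_one_div]
    exact ⟨1 / κ, γ, m 1, by positivity, hγ0, hmpos, by linarith, hab ▸ hinj.1, hinj.2⟩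

/-- Under each of the alternatives the two parts of an interval are independent. -/
lemma exists_pairLaw_eq_prod (h : FixedPointAlternatives F G) :
    ∃ μ ν : Measure ℝ, IsProbabilityMeasure μ ∧ IsProbabilityMeasure ν ∧
      pairLaw F G = μ.prod ν := by
  rcases h with ⟨α, γ, r, hα, hγ, hr, hr1, rfl, rfl⟩ | ⟨s, b, -, -, -, rfl, rfl⟩ | rfl | rfl
  · have ha : 0 < r * α := by positivity
    have hb : 0 < (1 - r) * α := mul_pos (by linarith) hα
    have e := gamma_prod_beta_map _ _ γ ha hb hγ
    rw [show r * α + (1 - r) * α = α by ring] at e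
    exact ⟨_, _, isProbabilityMeasure_gammaMeasure hb hγ,
      isProbabilityMeasure_gammaMeasure ha hγ, e⟩
  · refine ⟨Measure.dirac ((1 - b) * s), Measure.dirac (b * s), inferInstance, inferInstance, ?_⟩
    rw [pairLaw_dirac_dirac, Measure.dirac_prod_dirac]
  · refine ⟨F, Measure.dirac 0, inferInstance, inferInstance, ?_⟩
    rw [pairLaw, Measure.prod_dirac, Measure.map_map (by fun_prop) (by fun_prop)]
    congr 1
    ext x <;> simp
  · refine ⟨Measure.dirac 0, F, inferInstance, inferInstance, ?_⟩
    rw [pairLaw, Measure.prod_dirac, Measure.dirac_prod,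
      Measure.map_map (by fun_prop) (by fun_prop)]
    congr 1
    ext x <;> simp

lemma exchangeLaw_eq_infinitePi_of_alternatives (h : FixedPointAlternatives F G) :
    exchangeLaw F G = Measure.infinitePi fun _ : ℤ => F := by
  obtain ⟨μ, ν, _, _, e⟩ := exists_pairLaw_eq_prod h
  exact exchangeLaw_eq_of_pairLaw_eq_prod F G e

lemma alternatives_of_consecutive (hF : ∀ᵐ x ∂F, 0 < x) (hG : ∀ᵐ x ∂G, x ∈ Icc (0 : ℝ) 1)
    (k : ℤ) (h : (exchangeLaw F G).map (fun x => (x k, x (k + 1))) = F.prod F) :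
    FixedPointAlternatives F G :=
  fixedPointAlternatives_of_pairLaw_eq_prod hF hG (pairLaw_eq_prod_of_consecutive F G hF hG k h)

lemma exchangeLaw_eq_infinitePi_iff (hF : ∀ᵐ x ∂F, 0 < x) (hG : ∀ᵐ x ∂G, x ∈ Icc (0 : ℝ) 1) :
    exchangeLaw F G = (Measure.infinitePi fun _ : ℤ => F) ↔ FixedPointAlternatives F G := by
  refine ⟨fun h => alternatives_of_consecutive hF hG 0 ?_,
    exchangeLaw_eq_infinitePi_of_alternatives⟩
  rw [h]
  exact Measure.infinitePi_map_eval_prod (P := fun _ : ℤ => F) (by norm_num)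

lemma IsIID.map_eq_infinitePi {ι Ω : Type*} [MeasurableSpace Ω] {P : Measure Ω}
    [IsProbabilityMeasure P] {X : ι → Ω → ℝ} {μ : Measure ℝ} [IsProbabilityMeasure μ]
    (h : IsIID X μ P) : P.map (fun ω k => X k ω) = Measure.infinitePi fun _ : ι => μ := by
  rw [h.indep.map_fun_eq_infinitePi_map h.measurable]
  simp only [h.law]

lemma identDistrib_exchange_iff {Ω : Type*} [MeasurableSpace Ω] {P : Measure Ω}
    [IsProbabilityMeasure P] {τ b : ℤ → Ω → ℝ} (hτ : IsIID τ F P) (hb : IsIID b G P)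
    (hτb : IndepSeq τ b P) :
    IdentDistrib (fun ω => exchange (fun k => b k ω) (fun k => τ k ω)) (fun ω k => τ k ω) P P ↔
      exchangeLaw F G = Measure.infinitePi fun _ : ℤ => F := by
  have mτ : Measurable fun ω k => τ k ω := measurable_pi_lambda _ hτ.measurable
  have mb : Measurable fun ω k => b k ω := measurable_pi_lambda _ hb.measurable
  have hm : Measurable fun ω => exchange (fun k => b k ω) (fun k => τ k ω) :=
    measurable_exchange.comp (mτ.prodMk mb)
  have hlaw : P.map (fun ω => exchange (fun k => b k ω) (fun k => τ k ω)) = exchangeLaw F G := by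
    have e := (indepFun_iff_map_prod_eq_prod_map_map mτ.aemeasurable mb.aemeasurable).1 hτb
    rw [exchangeLaw, ← hτ.map_eq_infinitePi, ← hb.map_eq_infinitePi, ← e,
      Measure.map_map measurable_exchange (mτ.prodMk mb)]
    rfl
  rw [← hlaw, ← hτ.map_eq_infinitePi]
  exact ⟨fun h => h.map_eq, fun h => ⟨hm.aemeasurable, mτ.aemeasurable, h⟩⟩

end

/-! ### Palm measures and the inversion formula -/

/-- The Palm (Campbell) measure of the point process enumerated by `T`: the mass of `S` is the
expected number of points `T n` such that the pair of the location `T n` and the gap sequence seen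
from `T n` lies in `S`. -/
noncomputable def palmMeasure {Ω : Type*} [MeasurableSpace Ω] (T : ℤ → Ω → ℝ) (P : Measure Ω) :
    Measure (ℝ × (ℤ → ℝ)) :=
  Measure.sum fun n : ℤ => P.map fun ω => (T n ω, gapsFrom (fun k => T k ω) n)

/-- The sequence of points with `p.1` at index `0` and with gap sequence `p.2`. -/
def pointsFrom (p : ℝ × (ℤ → ℝ)) : ℤ → ℝ := fun k =>
  p.1 + ∑ i ∈ Finset.range k.toNat, p.2 (i + 1) - ∑ i ∈ Finset.range (-k).toNat, p.2 (-i)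

/-- The numbers of indices whose point lies in the given sets. -/
noncomputable def indexCounts {n : ℕ} (B : Fin n → Set ℝ) (t : ℤ → ℝ) : Fin n → ℕ∞ :=
  fun i => {k | t k ∈ B i}.encard

/-- The pairs of a location and a gap sequence for which the location is the first point that is
not negative. -/
def firstPointSet : Set (ℝ × (ℤ → ℝ)) := {p | p.1 - p.2 0 < 0 ∧ 0 ≤ p.1}

lemma measurableSet_firstPointSet : MeasurableSet firstPointSet := by
  have h1 : MeasurableSet {p : ℝ × (ℤ → ℝ) | p.1 - p.2 0 < 0} :=
    measurableSet_lt (by fun_prop) measurable_const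
  have h2 : MeasurableSet {p : ℝ × (ℤ → ℝ) | 0 ≤ p.1} :=
    measurableSet_le measurable_const measurable_fst
  exact h1.inter h2

lemma measurable_gapsFrom (n : ℤ) : Measurable fun t : ℤ → ℝ => gapsFrom t n := by
  unfold gapsFrom; fun_prop

lemma measurable_pointsFrom : Measurable pointsFrom := by
  unfold pointsFrom; fun_prop

lemma measurable_indexCounts {n : ℕ} {B : Fin n → Set ℝ} (hB : ∀ i, MeasurableSet (B i)) :
    Measurable (indexCounts B) := by
  refine measurable_pi_lambda _ fun i => measurable_encard.comp ?_
  rw [measurable_set_iff]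
  intro k
  exact measurableSet_setOfPred.1 (measurable_pi_apply k (hB i))

lemma pointsFrom_gapsFrom (t : ℤ → ℝ) (n k : ℤ) :
    pointsFrom (t n, gapsFrom t n) k = t (n + k) := by
  have h1 : ∀ m : ℕ, ∑ i ∈ Finset.range m, gapsFrom t n (i + 1) = t (n + m) - t n := by
    intro m
    have := Finset.sum_range_sub (fun i : ℕ => t (n + i)) m
    simp only [Nat.cast_zero, add_zero] at this
    rw [← this]
    refine Finset.sum_congr rfl fun i _ => ?_
    simp only [gapsFrom]
    push_cast
    congr 2; ring
  have h2 : ∀ m : ℕ, ∑ i ∈ Finset.range m, gapsFrom t n (-i) = t n - t (n - m) := by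
    intro m
    have := Finset.sum_range_sub' (fun i : ℕ => t (n - i)) m
    simp only [Nat.cast_zero, sub_zero] at this
    rw [← this]
    refine Finset.sum_congr rfl fun i _ => ?_
    simp only [gapsFrom]
    push_cast
    congr 2; ring
  simp only [pointsFrom]
  rw [h1, h2]
  rcases le_total 0 k with hk | hk
  · have e1 : ((k.toNat : ℕ) : ℤ) = k := Int.toNat_of_nonneg hk
    have e2 : (((-k).toNat : ℕ) : ℤ) = 0 := by simp [hk]
    rw [e1, e2]; simp
  · have e1 : ((k.toNat : ℕ) : ℤ) = 0 := by simp [hk]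
    have e2 : (((-k).toNat : ℕ) : ℤ) = -k := Int.toNat_of_nonneg (by linarith)
    rw [e1, e2]; simp

lemma encard_range_inter {t : ℤ → ℝ} (ht : Function.Injective t) (B : Set ℝ) :
    (range t ∩ B).encard = {k | t k ∈ B}.encard := by
  rw [inter_comm, ← image_preimage_eq_inter_range, ht.encard_image]; rfl

lemma indexCounts_shift {n : ℕ} (B : Fin n → Set ℝ) (t : ℤ → ℝ) (m : ℤ) :
    indexCounts B (fun k => t (m + k)) = indexCounts B t := by
  funext i
  exact encard_preimage_of_bijective (AddGroup.addLeft_bijective m) {k | t k ∈ B i}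

lemma exists_first_nonneg {t : ℤ → ℝ} (hm : StrictMono t) (htop : Tendsto t atTop atTop)
    (hbot : Tendsto t atBot atBot) : ∃ n, t n - gapsFrom t n 0 < 0 ∧ 0 ≤ t n := by
  obtain ⟨b, hb⟩ := (hbot.eventually (eventually_lt_atBot 0)).exists
  obtain ⟨n, hn, hmin⟩ := Int.exists_least_of_bdd (P := fun n => 0 ≤ t n)
    ⟨b, fun z hz => by
      by_contra h
      exact absurd (hm (not_le.1 h)) (by linarith)⟩
    (htop.eventually (eventually_ge_atTop 0)).exists
  refine ⟨n, ?_, hn⟩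
  by_contra h
  have := hmin (n - 1) (by simp [gapsFrom] at h; exact h)
  linarith

lemma first_nonneg_unique {t : ℤ → ℝ} (hm : StrictMono t) {n m : ℤ}
    (hn : t n - gapsFrom t n 0 < 0 ∧ 0 ≤ t n) (hm' : t m - gapsFrom t m 0 < 0 ∧ 0 ≤ t m) :
    n = m := by
  simp only [gapsFrom, add_zero, sub_sub_cancel] at hn hm'
  by_contra hne
  rcases lt_or_gt_of_ne hne with h | h
  · have := hm.monotone (show n ≤ m - 1 by linarith)
    linarith [hn.2, hm'.1]
  · have := hm.monotone (show m ≤ n - 1 by linarith)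
    linarith [hm'.2, hn.1]

lemma encard_range_inter_Icc {t : ℤ → ℝ} (hm : StrictMono t) {n : ℤ}
    (hn : t n - gapsFrom t n 0 < 0 ∧ 0 ≤ t n) (j : ℕ) (q : ℝ) :
    ((j + 1 : ℕ) : ℕ∞) ≤ (range t ∩ Icc 0 q).encard ↔ t (n + j) ≤ q := by
  simp only [gapsFrom, add_zero, sub_sub_cancel] at hn
  rw [encard_range_inter hm.injective]
  constructor
  · intro h
    by_contra hq
    have hsub : {k | t k ∈ Icc 0 q} ⊆ (Finset.Ico n (n + j) : Finset ℤ) := by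
      rintro k ⟨h0, h1⟩
      simp only [Finset.coe_Ico, mem_Ico]
      constructor
      · by_contra hk
        have := hm.monotone (show k ≤ n - 1 by linarith [not_le.1 hk])
        linarith
      · by_contra hk
        have := hm.monotone (not_lt.1 hk)
        linarith
    have := h.trans (encard_le_encard hsub)
    rw [encard_coe_eq_coe_finsetCard, Int.card_Ico, Nat.cast_le] at this
    simp at this
  · intro h
    have hsub : ((Finset.Icc n (n + j) : Finset ℤ) : Set ℤ) ⊆ {k | t k ∈ Icc 0 q} := by
      intro k hk
      simp only [Finset.coe_Icc, mem_Icc] at hk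
      exact ⟨hn.2.trans (hm.monotone hk.1), (hm.monotone hk.2).trans h⟩
    refine le_trans ?_ (encard_le_encard hsub)
    rw [encard_coe_eq_coe_finsetCard, Int.card_Icc, Nat.cast_le]
    omega

section
variable {Ω : Type*} [MeasurableSpace Ω] {P : Measure Ω} {T : ℤ → Ω → ℝ}

lemma measurable_location_gaps (hT : ∀ k, Measurable (T k)) (n : ℤ) :
    Measurable fun ω => (T n ω, gapsFrom (fun k => T k ω) n) :=
  (hT n).prodMk ((measurable_gapsFrom n).comp (measurable_pi_lambda _ hT))

lemma palmMeasure_apply (hT : ∀ k, Measurable (T k)) {S : Set (ℝ × (ℤ → ℝ))}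
    (hS : MeasurableSet S) :
    palmMeasure T P S = ∑' n : ℤ, P {ω | (T n ω, gapsFrom (fun k => T k ω) n) ∈ S} := by
  rw [palmMeasure, Measure.sum_apply _ hS]
  refine tsum_congr fun n => ?_
  rw [Measure.map_apply (measurable_location_gaps hT n) hS]
  rfl

/-- Inversion formula: an event that is expressed by the points as seen from the first
nonnegative point has the probability given by the Palm measure. -/
lemma measure_eq_palmMeasure (hT : IsPointEnumeration T P) {A : Set Ω} {S : Set (ℝ × (ℤ → ℝ))}
    (hS : MeasurableSet S)
    (h : ∀ᵐ ω ∂P, ∀ n, (T n ω, gapsFrom (fun k => T k ω) n) ∈ firstPointSet →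
      (ω ∈ A ↔ (T n ω, gapsFrom (fun k => T k ω) n) ∈ S)) :
    P A = palmMeasure T P (S ∩ firstPointSet) := by
  set M : ℤ → Set Ω := fun n =>
    {ω | (T n ω, gapsFrom (fun k => T k ω) n) ∈ S ∩ firstPointSet} with hM
  have hMm : ∀ n, MeasurableSet (M n) := fun n =>
    measurable_location_gaps hT.measurable n (hS.inter measurableSet_firstPointSet)
  have hA : A =ᵐ[P] ⋃ n, M n := by
    filter_upwards [h, hT.strictMono, hT.tendsto_atTop, hT.tendsto_atBot] with ω h1 h2 h3 h4
    apply propext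
    change ω ∈ A ↔ ω ∈ ⋃ n, M n
    simp only [mem_iUnion]
    constructor
    · intro hω
      obtain ⟨n, hn⟩ := exists_first_nonneg h2 h3 h4
      exact ⟨n, (h1 n hn).1 hω, hn⟩
    · rintro ⟨n, hn1, hn2⟩
      exact (h1 n hn2).2 hn1
  rw [palmMeasure_apply hT.measurable (hS.inter measurableSet_firstPointSet), measure_congr hA,
    measure_iUnion₀ _ fun n => (hMm n).nullMeasurableSet]
  intro n m hnm
  have : ∀ᵐ ω ∂P, ω ∉ M n ∩ M m := by
    filter_upwards [hT.strictMono] with ω h2 ⟨h3, h4⟩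
    exact hnm (first_nonneg_unique h2 h3.2 h4.2)
  exact measure_eq_zero_iff_ae_notMem.2 this

lemma palmMeasure_firstPointSet [IsProbabilityMeasure P] (hT : IsPointEnumeration T P) :
    palmMeasure T P firstPointSet = 1 := by
  have := measure_eq_palmMeasure hT (A := univ) (S := univ) MeasurableSet.univ
    (ae_of_all _ fun ω n _ => by simp)
  rw [univ_inter, measure_univ] at this
  exact this.symm

lemma indexCounts_ae_eq (hT : IsPointEnumeration T P) {n : ℕ} (B : Fin n → Set ℝ) :
    (fun ω i => ((range fun k => T k ω) ∩ B i).encard)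
      =ᵐ[P] fun ω => indexCounts B fun k => T k ω := by
  filter_upwards [hT.strictMono] with ω h
  funext i
  exact encard_range_inter h.injective (B i)

lemma aemeasurable_counts (hT : IsPointEnumeration T P) {n : ℕ} {B : Fin n → Set ℝ}
    (hB : ∀ i, MeasurableSet (B i)) :
    AEMeasurable (fun ω i => ((range fun k => T k ω) ∩ B i).encard) P :=
  ⟨_, (measurable_indexCounts hB).comp (measurable_pi_lambda _ hT.measurable),
    indexCounts_ae_eq hT B⟩

/-- The Palm measure determines the law of a point process. -/
lemma samePointProcessLaw_of_palmMeasure_eq {Ω' : Type*} [MeasurableSpace Ω'] {P' : Measure Ω'}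
    {T' : ℤ → Ω' → ℝ} (hT : IsPointEnumeration T P) (hT' : IsPointEnumeration T' P')
    (h : palmMeasure T P = palmMeasure T' P') :
    SamePointProcessLaw (fun ω => range fun k => T k ω) P (fun ω => range fun k => T' k ω) P' := by
  intro n B hB
  refine ⟨aemeasurable_counts hT hB, aemeasurable_counts hT' hB, ?_⟩
  rw [Measure.map_congr (indexCounts_ae_eq hT B), Measure.map_congr (indexCounts_ae_eq hT' B)]
  have m : Measurable fun ω => indexCounts B fun k => T k ω :=
    (measurable_indexCounts hB).comp (measurable_pi_lambda _ hT.measurable)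
  have m' : Measurable fun ω => indexCounts B fun k => T' k ω :=
    (measurable_indexCounts hB).comp (measurable_pi_lambda _ hT'.measurable)
  ext U hU
  have hS : MeasurableSet {p | indexCounts B (pointsFrom p) ∈ U} :=
    ((measurable_indexCounts hB).comp measurable_pointsFrom) hU
  have hshift : ∀ (t : ℤ → ℝ) (j : ℤ),
      indexCounts B (pointsFrom (t j, gapsFrom t j)) = indexCounts B t := by
    intro t j
    rw [← indexCounts_shift B t j]
    congr 1
    funext k
    exact pointsFrom_gapsFrom t j k
  rw [Measure.map_apply m hU, Measure.map_apply m' hU,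
    measure_eq_palmMeasure hT hS, h, ← measure_eq_palmMeasure hT' hS]
  · exact ae_of_all _ fun ω j _ => iff_of_eq
      (congrArg (· ∈ U) (hshift (fun k => T' k ω) j).symm)
  · exact ae_of_all _ fun ω j _ => iff_of_eq
      (congrArg (· ∈ U) (hshift (fun k => T k ω) j).symm)

end

/-- Finite measures on `ℝⁿ` with the same distribution function are equal. -/
lemma ext_of_Iic_fin {n : ℕ} {μ ν : Measure (Fin n → ℝ)} [IsFiniteMeasure μ]
    (huniv : μ univ = ν univ) (h : ∀ q, μ (Iic q) = ν (Iic q)) : μ = ν := by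
  refine ext_of_generate_finite (range Iic) ?_ ?_ ?_ huniv
  · refine le_antisymm ?_ (MeasurableSpace.generateFrom_le ?_)
    · refine iSup_le fun i => ?_
      rw [BorelSpace.measurable_eq (α := ℝ), borel_eq_generateFrom_Iic,
        MeasurableSpace.comap_generateFrom]
      refine MeasurableSpace.generateFrom_le ?_
      rintro _ ⟨_, ⟨a, rfl⟩, rfl⟩
      have : (fun v : Fin n → ℝ => v i) ⁻¹' Iic a
          = ⋃ N : ℕ, Iic (Function.update (fun _ => (N : ℝ)) i a) := by
        ext v
        simp only [mem_preimage, mem_Iic, mem_iUnion]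
        constructor
        · intro hv
          obtain ⟨N, hN⟩ := exists_nat_ge (∑ j, |v j|)
          refine ⟨N, fun j => ?_⟩
          by_cases hj : j = i
          · subst hj; simpa using hv
          · rw [Function.update_of_ne hj]
            exact (le_abs_self _).trans ((Finset.single_le_sum (f := fun j => |v j|)
              (fun _ _ => abs_nonneg _) (Finset.mem_univ j)).trans hN)
        · rintro ⟨N, hN⟩
          simpa using hN i
      rw [this]
      exact MeasurableSet.iUnion fun N => MeasurableSpace.measurableSet_generateFrom ⟨_, rfl⟩
    · rintro _ ⟨q, rfl⟩
      exact measurableSet_Iic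
  · rintro _ ⟨p, rfl⟩ _ ⟨q, rfl⟩ -
    exact ⟨p ⊓ q, Iic_inter_Iic.symm⟩
  · rintro _ ⟨q, rfl⟩
    exact h q

/-! ### Recovering gaps from the law of a point process -/

section
variable {Ω : Type*} [MeasurableSpace Ω] {P : Measure Ω} {T : ℤ → Ω → ℝ}

/-- The locations of the second, third and fourth nonnegative point, when the location `p.1` is
that of the first. -/
noncomputable def nextPoints (p : ℝ × (ℤ → ℝ)) : Fin 3 → ℝ := fun j =>
  pointsFrom p ((j : ℕ) + 1 : ℕ)

lemma measurable_nextPoints : Measurable nextPoints :=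
  measurable_pi_lambda _ fun _ => (measurable_pi_apply _).comp measurable_pointsFrom

lemma nextPoints_sub (p : ℝ × (ℤ → ℝ)) :
    (nextPoints p 1 - nextPoints p 0, nextPoints p 2 - nextPoints p 1) = (p.2 2, p.2 3) := by
  have h : ∀ n : ℕ, pointsFrom p n = p.1 + ∑ i ∈ Finset.range n, p.2 (i + 1) := by
    intro n; simp [pointsFrom]
  simp only [nextPoints, h]
  ext <;> norm_num [Finset.sum_range_succ]

/-- With the first nonnegative point at index `0`, the point of index `j + 1` is at most `q j`
exactly if `[0, q j]` contains at least `j + 2` points; so box probabilities are count probabilities. -/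
lemma map_nextPoints_Iic (hT : IsPointEnumeration T P) (q : Fin 3 → ℝ) :
    ((palmMeasure T P).restrict firstPointSet).map nextPoints (Iic q)
      = P {ω | ∀ j : Fin 3, (((j : ℕ) + 1 + 1 : ℕ) : ℕ∞)
          ≤ ((range fun k => T k ω) ∩ Icc 0 (q j)).encard} := by
  have hS : MeasurableSet (nextPoints ⁻¹' Iic q) := measurable_nextPoints measurableSet_Iic
  rw [Measure.map_apply measurable_nextPoints measurableSet_Iic, Measure.restrict_apply hS,
    measure_eq_palmMeasure hT hS]
  filter_upwards [hT.strictMono] with ω hω n hn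
  simp only [mem_preimage, mem_Iic, Pi.le_def, nextPoints]
  refine forall_congr' fun j => ?_
  rw [pointsFrom_gapsFrom (fun k => T k ω) n]
  exact encard_range_inter_Icc hω hn _ _

/-- The joint law of the points after the first nonnegative one is determined by the law of the
point process. -/
lemma map_nextPoints_eq [IsProbabilityMeasure P] {Ω' : Type*} [MeasurableSpace Ω']
    {P' : Measure Ω'} [IsProbabilityMeasure P'] {T' : ℤ → Ω' → ℝ}
    (hT : IsPointEnumeration T P) (hT' : IsPointEnumeration T' P')
    (h : SamePointProcessLaw (fun ω => range fun k => T k ω) P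
      (fun ω => range fun k => T' k ω) P') :
    ((palmMeasure T P).restrict firstPointSet).map nextPoints
      = ((palmMeasure T' P').restrict firstPointSet).map nextPoints := by
  have huniv : ((palmMeasure T P).restrict firstPointSet).map nextPoints univ = 1 := by
    rw [Measure.map_apply measurable_nextPoints MeasurableSet.univ, preimage_univ,
      Measure.restrict_apply_univ, palmMeasure_firstPointSet hT]
  have huniv' : ((palmMeasure T' P').restrict firstPointSet).map nextPoints univ = 1 := by
    rw [Measure.map_apply measurable_nextPoints MeasurableSet.univ, preimage_univ,
      Measure.restrict_apply_univ, palmMeasure_firstPointSet hT']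
  have : IsFiniteMeasure (((palmMeasure T P).restrict firstPointSet).map nextPoints) :=
    ⟨by rw [huniv]; exact ENNReal.one_lt_top⟩
  refine ext_of_Iic_fin (huniv.trans huniv'.symm) fun q => ?_
  rw [map_nextPoints_Iic hT, map_nextPoints_Iic hT']
  exact (h 3 (fun j => Icc 0 (q j)) fun _ => measurableSet_Icc).measure_mem_eq
    (s := {v | ∀ j : Fin 3, (((j : ℕ) + 1 + 1 : ℕ) : ℕ∞) ≤ v j}) MeasurableSet.of_discrete

end

/-- The gaps behind the first nonnegative point have their Palm law if they are independent of the
gap that contains the origin, because the Palm law is biased only by the length of that gap. -/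
lemma map_gaps_restrict_firstPointSet {ρ : ℝ≥0} {Q : Measure (ℤ → ℝ)} [IsProbabilityMeasure Q]
    (h1 : ((ρ • volume : Measure ℝ).prod Q) firstPointSet = 1)
    (hind : IndepFun (fun g : ℤ → ℝ => g 0) (fun g => (g 2, g 3)) Q) :
    (((ρ • volume : Measure ℝ).prod Q).restrict firstPointSet).map (fun p => (p.2 2, p.2 3))
      = Q.map fun g => (g 2, g 3) := by
  have value : ∀ S : Set (ℝ × ℝ), MeasurableSet S →
      (((ρ • volume : Measure ℝ).prod Q).restrict firstPointSet).map (fun p => (p.2 2, p.2 3)) S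
        = (∫⁻ g, ρ * ENNReal.ofReal (g 0) ∂Q) * Q.map (fun g => (g 2, g 3)) S := by
    intro S hS
    have hm : Measurable fun g : ℤ → ℝ => (g 2, g 3) := by fun_prop
    have hm' : Measurable fun p : ℝ × (ℤ → ℝ) => (p.2 2, p.2 3) := by fun_prop
    rw [Measure.map_apply hm' hS, Measure.restrict_apply (hm' hS),
      Measure.prod_apply_symm ((hm' hS).inter measurableSet_firstPointSet),
      Measure.map_apply hm hS, ← lintegral_indicator_one (hm hS)]
    have mS : Measurable (S.indicator (1 : ℝ × ℝ → ℝ≥0∞)) := measurable_one.indicator hS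
    have mρ : Measurable fun x : ℝ => (ρ : ℝ≥0∞) * ENNReal.ofReal x := by fun_prop
    have := lintegral_mul_eq_lintegral_mul_lintegral_of_indepFun
      (mρ.comp (measurable_pi_apply 0)) (mS.comp hm) (hind.comp mρ mS)
    refine Eq.trans (lintegral_congr fun g => ?_) this
    simp only [Pi.mul_apply, Function.comp]
    by_cases hg : (g 2, g 3) ∈ S
    · have e : (fun x : ℝ => (x, g)) ⁻¹' ((fun p : ℝ × (ℤ → ℝ) => (p.2 2, p.2 3)) ⁻¹' S ∩
          firstPointSet) = Ico 0 (g 0) := by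
        ext x
        simp [firstPointSet, hg, and_comm]
      rw [e, indicator_of_mem hg, Measure.smul_apply, Real.volume_Ico, sub_zero]
      simp [ENNReal.smul_def]
    · have e : (fun x : ℝ => (x, g)) ⁻¹' ((fun p : ℝ × (ℤ → ℝ) => (p.2 2, p.2 3)) ⁻¹' S ∩
          firstPointSet) = ∅ := by
        ext x
        simp [hg]
      rw [e, indicator_of_notMem hg]
      simp
  have hone : ∫⁻ g, ρ * ENNReal.ofReal (g 0) ∂Q = 1 := by
    have := value univ MeasurableSet.univ
    rw [Measure.map_apply (by fun_prop) MeasurableSet.univ, preimage_univ,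
      Measure.restrict_apply_univ, h1, Measure.map_apply (by fun_prop) MeasurableSet.univ,
      preimage_univ, measure_univ, mul_one] at this
    exact this.symm
  ext S hS
  rw [value S hS, hone, one_mul]

/-! ### The process of division points -/

/-- The defining identity of the Palm gap law, as a product formula for the Palm measure. -/
lemma HasPalmGapLaw.exists_palmMeasure_eq {Ω : Type*} [MeasurableSpace Ω] {P : Measure Ω}
    {T : ℤ → Ω → ℝ} {Q : Measure (ℤ → ℝ)} [IsProbabilityMeasure Q] (h : HasPalmGapLaw T Q P)
    (hT : ∀ k, Measurable (T k)) :
    ∃ ρ : ℝ≥0, ρ ≠ 0 ∧ palmMeasure T P = (ρ • volume : Measure ℝ).prod Q := by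
  obtain ⟨ρ, h0, htop, h⟩ := h
  lift ρ to ℝ≥0 using htop
  refine ⟨ρ, by exact_mod_cast h0, (Measure.prod_eq fun B A hB hA => ?_).symm⟩
  rw [palmMeasure_apply hT (hB.prod hA), Measure.smul_apply, ENNReal.smul_def, smul_eq_mul,
    ← h B A hB hA]
  rfl

/-- The law of the gap sequence seen from a division point, when the process that is divided
has gap law `Q`. The gap ending in the division point of the interval `0` is formed from the intervals
`-1` and `0`, hence the shift of the index. -/
noncomputable def dividedGapLaw (Q : Measure (ℤ → ℝ)) (G : Measure ℝ) [IsProbabilityMeasure G] :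
    Measure (ℤ → ℝ) :=
  (Q.prod (Measure.infinitePi fun _ : ℤ => G)).map fun p k => exchange p.2 p.1 (k - 1)

lemma dividedGapLaw_eq_map (F G : Measure ℝ) [IsProbabilityMeasure F] [IsProbabilityMeasure G] :
    dividedGapLaw (Measure.infinitePi fun _ : ℤ => F) G
      = (exchangeLaw F G).map fun x k => x (k - 1) := by
  rw [dividedGapLaw, exchangeLaw, Measure.map_map (by fun_prop) measurable_exchange]
  rfl

/-- The division point of the `k`-th interval. -/
def divisionPoint {Ω : Type*} (b T : ℤ → Ω → ℝ) (k : ℤ) (ω : Ω) : ℝ :=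
  T (k - 1) ω + b k ω * (T k ω - T (k - 1) ω)

/-- The gaps between division points arise from the original gaps by the exchange operator. -/
lemma gapsFrom_divisionPoint {Ω : Type*} (b T : ℤ → Ω → ℝ) (n : ℤ) (ω : Ω) :
    gapsFrom (fun k => divisionPoint b T k ω) n = fun k =>
      exchange (fun k => b (n + k) ω) (gapsFrom (fun k => T k ω) n) (k - 1) := by
  funext k
  simp only [gapsFrom, divisionPoint, exchange]
  rw [show n + (k - 1) = n + k - 1 by ring, show n + (k - 1 + 1) = n + k by ring]
  ring

section
variable {Ω : Type*} [MeasurableSpace Ω] {P : Measure Ω}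
  {T b : ℤ → Ω → ℝ} {G : Measure ℝ}

lemma measurable_divisionPoint (hT : ∀ k, Measurable (T k)) (hb : ∀ k, Measurable (b k)) (k : ℤ) :
    Measurable (divisionPoint b T k) := by
  have := hT k
  have := hT (k - 1)
  have := hb k
  unfold divisionPoint
  fun_prop

/-- Division is covariant under translations: a division point differs from the right end of its
interval by an amount that depends only on the gaps and the proportions, so the Palm measure of
the division points is again a product with Lebesgue measure, of the same intensity. -/
lemma palmMeasure_divisionPoint [IsProbabilityMeasure P] [IsProbabilityMeasure G] {ρ : ℝ≥0}
    {Q : Measure (ℤ → ℝ)} [IsProbabilityMeasure Q]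
    (hT : ∀ k, Measurable (T k)) (hb : IsIID b G P) (hTb : IndepSeq T b P)
    (h : palmMeasure T P = (ρ • volume : Measure ℝ).prod Q) :
    palmMeasure (divisionPoint b T) P = (ρ • volume : Measure ℝ).prod (dividedGapLaw Q G) := by
  set N := Measure.infinitePi fun _ : ℤ => G with hN
  have mT : Measurable fun ω k => T k ω := measurable_pi_lambda _ hT
  have mb : Measurable fun ω k => b k ω := measurable_pi_lambda _ hb.measurable
  set ξ : (ℝ × (ℤ → ℝ)) × (ℤ → ℝ) → ℝ × (ℤ → ℝ) := fun p =>
    (p.1.1 - (1 - p.2 0) * p.1.2 0, fun k => exchange p.2 p.1.2 (k - 1)) with hξ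
  have mexch : Measurable fun p : (ℤ → ℝ) × (ℤ → ℝ) => fun k => exchange p.2 p.1 (k - 1) := by
    unfold exchange; fun_prop
  have mξ : Measurable ξ := by
    simp only [hξ, exchange]; fun_prop
  have joint : ∀ n : ℤ,
      P.map (fun ω => ((T n ω, gapsFrom (fun k => T k ω) n), fun k => b (n + k) ω))
      = (P.map fun ω => (T n ω, gapsFrom (fun k => T k ω) n)).prod N := by
    intro n
    have mshift : Measurable fun (x : ℤ → ℝ) k => x (n + k) := by fun_prop
    have hi : IndepFun (fun ω => (T n ω, gapsFrom (fun k => T k ω) n)) (fun ω k => b (n + k) ω) P :=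
      IndepFun.comp (φ := fun t : ℤ → ℝ => (t n, gapsFrom t n)) hTb
        ((measurable_pi_apply n).prodMk (measurable_gapsFrom n)) mshift
    have mb' : Measurable fun ω k => b (n + k) ω := mshift.comp mb
    rw [(indepFun_iff_map_prod_eq_prod_map_map (measurable_location_gaps hT n).aemeasurable
      mb'.aemeasurable).1 hi]
    congr 1
    rw [hN, ← infinitePi_map_shift G n, ← hb.map_eq_infinitePi, Measure.map_map mshift mb]
    rfl
  have e1 : palmMeasure (divisionPoint b T) P = ((palmMeasure T P).prod N).map ξ := by
    rw [palmMeasure, palmMeasure, Measure.prod_sum_left, Measure.map_sum mξ.aemeasurable]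
    congr 1
    funext n
    rw [← joint n, Measure.map_map mξ ((measurable_location_gaps hT n).prodMk
      (measurable_pi_lambda _ fun k => hb.measurable (n + k)))]
    congr 1
    funext ω
    simp only [Function.comp, hξ, gapsFrom_divisionPoint]
    refine Prod.ext ?_ rfl
    simp only [divisionPoint, gapsFrom, add_zero]
    ring
  have skew := MeasurePreserving.skew_product (μa := Q.prod N) (μc := (ρ • volume : Measure ℝ))
    (μd := (ρ • volume : Measure ℝ)) (f := fun w k => exchange w.2 w.1 (k - 1))
    (g := fun w x => x - (1 - w.2 0) * w.1 0) ⟨mexch, rfl⟩ (by fun_prop)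
    (ae_of_all _ fun w => map_sub_right_eq_self _ _)
  have := (Measure.measurePreserving_swap.comp skew).comp (Measure.measurePreserving_swap.comp
    (measurePreserving_prodAssoc (ρ • volume : Measure ℝ) Q N))
  rw [e1, h]
  exact this.map_eq

lemma ae_divisionPoint_between (hT : IsPointEnumeration T P) (hb : IsIID b G P)
    (hG : ∀ᵐ x ∂G, x ∈ Icc (0 : ℝ) 1) : ∀ᵐ ω ∂P, ∀ n, T (n - 1) ω ≤ divisionPoint b T n ω ∧
      divisionPoint b T n ω ≤ T n ω := by
  have hbI : ∀ᵐ ω ∂P, ∀ k, b k ω ∈ Icc (0 : ℝ) 1 := by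
    rw [ae_all_iff]
    intro k
    rw [← hb.law k] at hG
    exact ae_of_ae_map (hb.measurable k).aemeasurable hG
  filter_upwards [hbI, hT.strictMono] with ω h1 h2 n
  have h := h2.monotone (show n - 1 ≤ n by linarith)
  have h3 := h1 n
  simp only [divisionPoint] at *
  constructor <;> nlinarith [h3.1, h3.2]

/-- The enumeration of the division points is strictly increasing if almost surely no two of them
coincide as seen under the Palm law. -/
lemma isPointEnumeration_divisionPoint {ρ : ℝ≥0} {Q : Measure (ℤ → ℝ)} [IsProbabilityMeasure Q]
    (hT : IsPointEnumeration T P) (hb : IsIID b G P) (hG : ∀ᵐ x ∂G, x ∈ Icc (0 : ℝ) 1)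
    (h : palmMeasure (divisionPoint b T) P = (ρ • volume : Measure ℝ).prod Q)
    (hQ : Q {g | g 0 = 0} = 0) : IsPointEnumeration (divisionPoint b T) P := by
  have hm := measurable_divisionPoint hT.measurable hb.measurable
  have hS : MeasurableSet {p : ℝ × (ℤ → ℝ) | p.2 0 = 0} :=
    measurableSet_eq_fun (by fun_prop) measurable_const
  have hne : ∀ᵐ ω ∂P, ∀ n, gapsFrom (fun k => divisionPoint b T k ω) n 0 ≠ 0 := by
    have h0 : palmMeasure (divisionPoint b T) P {p | p.2 0 = 0} = 0 := by
      rw [h, show {p : ℝ × (ℤ → ℝ) | p.2 0 = 0} = univ ×ˢ {g | g 0 = 0} by ext; simp,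
        Measure.prod_prod, hQ, mul_zero]
    rw [palmMeasure_apply hm hS, ENNReal.tsum_eq_zero] at h0
    rw [ae_all_iff]
    intro n
    exact measure_eq_zero_iff_ae_notMem.1 (h0 n)
  have hbetween := ae_divisionPoint_between hT hb hG
  refine ⟨hm, ?_, ?_, ?_⟩
  · filter_upwards [hbetween, hne] with ω h1 h2
    refine strictMono_int_of_lt_succ fun n => ?_
    have h3 := h2 (n + 1)
    have h4 := (h1 n).2
    have h5 := (h1 (n + 1)).1
    simp only [gapsFrom, add_zero, add_sub_cancel_right] at h3 h5
    exact lt_of_le_of_ne (h4.trans h5) fun e => h3 (by rw [e, sub_self])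
  · filter_upwards [hbetween, hT.tendsto_atTop] with ω h1 h2
    refine tendsto_atTop_mono (fun n => (h1 n).1) ?_
    exact h2.comp (tendsto_atTop_add_const_right _ (-1) tendsto_id)
  · filter_upwards [hbetween, hT.tendsto_atBot] with ω h1 h2
    exact tendsto_atBot_mono (fun n => (h1 n).2) h2

/-- The Palm measure counts, on average, the indices whose point and gaps lie in a given set. -/
lemma lintegral_encard_eq_palmMeasure (hT : ∀ k, Measurable (T k)) {S : Set (ℝ × (ℤ → ℝ))}
    (hS : MeasurableSet S) :
    ∫⁻ ω, (({n | (T n ω, gapsFrom (fun k => T k ω) n) ∈ S}.encard : ℕ∞) : ℝ≥0∞) ∂P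
      = palmMeasure T P S := by
  have hm : ∀ n, MeasurableSet {ω | (T n ω, gapsFrom (fun k => T k ω) n) ∈ S} := fun n =>
    measurable_location_gaps hT n hS
  rw [palmMeasure_apply hT hS]
  have he : ∀ ω, (({n | (T n ω, gapsFrom (fun k => T k ω) n) ∈ S}.encard : ℕ∞) : ℝ≥0∞)
      = ∑' n, {ω | (T n ω, gapsFrom (fun k => T k ω) n) ∈ S}.indicator 1 ω := fun ω => by
    rw [← ENNReal.tsum_set_one, tsum_subtype _ fun _ => (1 : ℝ≥0∞)]
    rfl
  simp_rw [he]
  rw [lintegral_tsum fun n => ?_]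
  · refine tsum_congr fun n => ?_
    rw [← lintegral_indicator_one (hm n)]
  · exact (measurable_one.indicator (hm n)).aemeasurable

/-- An injective enumeration: the mean number of points in `B` is the Palm mass over `B`. -/
lemma lintegral_encard_range_inter (hT : IsPointEnumeration T P) {B : Set ℝ}
    (hB : MeasurableSet B) :
    ∫⁻ ω, ((((range fun k => T k ω) ∩ B).encard : ℕ∞) : ℝ≥0∞) ∂P
      = palmMeasure T P (B ×ˢ univ) := by
  rw [← lintegral_encard_eq_palmMeasure hT.measurable (hB.prod MeasurableSet.univ)]
  refine lintegral_congr_ae ?_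
  filter_upwards [hT.strictMono] with ω h
  rw [encard_range_inter h.injective]
  simp

/-- Coinciding points are counted only once: each point of the range of a monotone enumeration
has a first index, and the gap that ends there does not vanish. -/
lemma lintegral_encard_range_inter_le (hT : ∀ k, Measurable (T k))
    (hmono : ∀ᵐ ω ∂P, Monotone fun k => T k ω)
    (hbot : ∀ᵐ ω ∂P, Tendsto (fun k => T k ω) atBot atBot) {B : Set ℝ} (hB : MeasurableSet B) :
    ∫⁻ ω, ((((range fun k => T k ω) ∩ B).encard : ℕ∞) : ℝ≥0∞) ∂P
      ≤ palmMeasure T P (B ×ˢ {g | g 0 ≠ 0}) := by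
  have hS : MeasurableSet {g : ℤ → ℝ | g 0 ≠ 0} :=
    (measurable_pi_apply 0) (measurableSet_singleton 0).compl
  rw [← lintegral_encard_eq_palmMeasure hT (hB.prod hS)]
  refine lintegral_mono_ae ?_
  filter_upwards [hmono, hbot] with ω h1 h2
  rw [ENat.toENNReal_le]
  refine (encard_le_encard ?_).trans (encard_image_le (fun k => T k ω) _)
  rintro _ ⟨⟨m, rfl⟩, hm⟩
  obtain ⟨c, hc⟩ := (h2.eventually (eventually_lt_atBot (T m ω))).exists
  obtain ⟨n, hn, hmin⟩ := Int.exists_least_of_bdd (P := fun n => T m ω ≤ T n ω)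
    ⟨c, fun z hz => by
      by_contra h
      have := h1 (not_le.1 h).le
      simp only at this
      linarith⟩ ⟨m, le_rfl⟩
  have he : T n ω = T m ω := le_antisymm (h1 (hmin m le_rfl)) hn
  refine ⟨n, ⟨he ▸ hm, ?_⟩, he⟩
  intro h0
  simp only [gapsFrom, add_zero] at h0
  have := hmin (n - 1) (by linarith)
  linarith

end

/-- A gap is independent of the gaps two and three steps ahead, since these are formed from
different intervals. -/
lemma indepFun_dividedGapLaw (F G : Measure ℝ) [IsProbabilityMeasure F] [IsProbabilityMeasure G] :
    IndepFun (fun g : ℤ → ℝ => g 0) (fun g => (g 2, g 3))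
      (dividedGapLaw (Measure.infinitePi fun _ : ℤ => F) G) := by
  set M := Measure.infinitePi fun _ : ℤ => pairLaw F G
  set θ : (ℤ → ℝ × ℝ) → ℤ → ℝ := fun z k => (z (k - 1)).1 + (z (k - 1 + 1)).2 with hθ
  have mθ : Measurable θ := by fun_prop
  have e : dividedGapLaw (Measure.infinitePi fun _ : ℤ => F) G = M.map θ := by
    rw [dividedGapLaw_eq_map, exchangeLaw_eq_map_pairs, Measure.map_map (by fun_prop) (by fun_prop)]
    rfl
  have hi := (iIndepFun_infinitePi (P := fun _ : ℤ => pairLaw F G) (X := fun _ z => z)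
    (by fun_prop)).indepFun_finset {-1, 0} {1, 2, 3} (by decide) (by fun_prop)
  have hc := hi.comp
    (φ := fun v : ({-1, 0} : Finset ℤ) → ℝ × ℝ => (v ⟨-1, by simp⟩).1 + (v ⟨0, by simp⟩).2)
    (ψ := fun v : ({1, 2, 3} : Finset ℤ) → ℝ × ℝ =>
      ((v ⟨1, by simp⟩).1 + (v ⟨2, by simp⟩).2, (v ⟨2, by simp⟩).1 + (v ⟨3, by simp⟩).2))
    (by fun_prop) (by fun_prop)
  rw [e, indepFun_iff_measure_inter_preimage_eq_mul]
  intro s t hs ht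
  have m1 : Measurable fun g : ℤ → ℝ => g 0 := by fun_prop
  have m2 : Measurable fun g : ℤ → ℝ => (g 2, g 3) := by fun_prop
  rw [Measure.map_apply mθ ((m1 hs).inter (m2 ht)), Measure.map_apply mθ (m1 hs),
    Measure.map_apply mθ (m2 ht)]
  have := indepFun_iff_measure_inter_preimage_eq_mul.1 hc s t hs ht
  simpa [θ, Function.comp_def, preimage_preimage, preimage_inter] using this

instance (Q : Measure (ℤ → ℝ)) [IsProbabilityMeasure Q] (G : Measure ℝ) [IsProbabilityMeasure G] :
    IsProbabilityMeasure (dividedGapLaw Q G) :=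
  Measure.isProbabilityMeasure_map (by unfold exchange; fun_prop)

/-! ### Processes invariant under division -/

section
variable {Ω : Type*} [MeasurableSpace Ω] {P : Measure Ω}
  {T b : ℤ → Ω → ℝ} {F G : Measure ℝ}

/-- Under the alternatives the divided process has the Palm measure of the original one. -/
lemma samePointProcessLaw_of_alternatives [IsProbabilityMeasure P] [IsProbabilityMeasure F]
    [IsProbabilityMeasure G] (hF : ∀ᵐ x ∂F, 0 < x) (hG : ∀ᵐ x ∂G, x ∈ Icc (0 : ℝ) 1)
    (hT : IsStationaryRenewal T F P) (hb : IsIID b G P) (hTb : IndepSeq T b P)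
    (h : FixedPointAlternatives F G) :
    SamePointProcessLaw (fun ω => range fun k => divisionPoint b T k ω) P
      (fun ω => range fun k => T k ω) P := by
  obtain ⟨ρ, -, hρ⟩ := hT.palm.exists_palmMeasure_eq hT.enumeration.measurable
  have hD := palmMeasure_divisionPoint hT.enumeration.measurable hb hTb hρ
  have hQ : dividedGapLaw (Measure.infinitePi fun _ : ℤ => F) G
      = Measure.infinitePi fun _ => F := by
    rw [dividedGapLaw_eq_map, exchangeLaw_eq_infinitePi_of_alternatives h]
    have := infinitePi_map_shift F (-1)
    simpa only [neg_add_eq_sub] using this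
  rw [hQ] at hD
  refine samePointProcessLaw_of_palmMeasure_eq
    (isPointEnumeration_divisionPoint hT.enumeration hb hG hD ?_) hT.enumeration (hD.trans hρ.symm)
  have hz : F {0} = 0 := by
    refine measure_mono_null (fun x hx => ?_) (ae_iff.1 hF)
    rw [mem_singleton_iff.1 hx]
    exact lt_irrefl _
  have := Measure.infinitePi_map_eval (fun _ : ℤ => F) 0
  rw [← this, Measure.map_apply (by fun_prop) (measurableSet_singleton 0)] at hz
  exact hz

/-- If the division points have the law of the original process, no two of them coincide, since
otherwise their intensity would be smaller. -/
lemma dividedGapLaw_eq_zero_of_samePointProcessLaw (hG : ∀ᵐ x ∂G, x ∈ Icc (0 : ℝ) 1)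
    (hT : IsPointEnumeration T P) (hb : IsIID b G P) {ρ : ℝ≥0} (hρ0 : ρ ≠ 0)
    {Q Q' : Measure (ℤ → ℝ)} [IsProbabilityMeasure Q] [IsProbabilityMeasure Q']
    (hρ : palmMeasure T P = (ρ • volume : Measure ℝ).prod Q)
    (hD : palmMeasure (divisionPoint b T) P = (ρ • volume : Measure ℝ).prod Q')
    (h : SamePointProcessLaw (fun ω => range fun k => divisionPoint b T k ω) P
      (fun ω => range fun k => T k ω) P) : Q' {g | g 0 = 0} = 0 := by
  have hbetween := ae_divisionPoint_between hT hb hG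
  have hB : MeasurableSet (Ico (0 : ℝ) 1) := measurableSet_Ico
  have h1 := lintegral_encard_range_inter_le (P := P)
    (measurable_divisionPoint hT.measurable hb.measurable) (by
      filter_upwards [hbetween] with ω h1
      refine monotone_int_of_le_succ fun n => ?_
      have := (h1 (n + 1)).1
      rw [add_sub_cancel_right] at this
      exact (h1 n).2.trans this) (by
      filter_upwards [hbetween, hT.tendsto_atBot] with ω h1 h2
      exact tendsto_atBot_mono (fun n => (h1 n).2) h2) hB
  have h2 := lintegral_encard_range_inter hT hB
  have h3 := ((h 1 (fun _ => Ico 0 1) fun _ => hB).comp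
    (u := fun v : Fin 1 → ℕ∞ => ((v 0 : ℕ∞) : ℝ≥0∞)) Measurable.of_discrete).lintegral_eq
  simp only [Function.comp_def] at h3
  rw [h3, h2, hρ, hD, Measure.prod_prod, Measure.prod_prod, measure_univ] at h1
  have hvol : (ρ • volume : Measure ℝ) (Ico 0 1) = ρ := by
    rw [Measure.smul_apply, Real.volume_Ico, sub_zero, ENNReal.ofReal_one, ENNReal.smul_def,
      smul_eq_mul, mul_one]
  rw [hvol] at h1
  have h4 : 1 ≤ Q' {g | g 0 ≠ 0} :=
    (ENNReal.mul_le_mul_iff_right (by exact_mod_cast hρ0) ENNReal.coe_ne_top).1 h1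
  have hS : MeasurableSet {g : ℤ → ℝ | g 0 ≠ 0} :=
    (measurable_pi_apply 0) (measurableSet_singleton 0).compl
  have h5 := (prob_compl_eq_zero_iff hS).2 (le_antisymm prob_le_one h4)
  rwa [show {g : ℤ → ℝ | g 0 ≠ 0}ᶜ = {g | g 0 = 0} from ext fun _ => not_not] at h5

/-- The law of the process determines that of two consecutive gaps far enough from the origin, so
two consecutive entries of the exchanged sequence are independent with law `F`. -/
lemma alternatives_of_samePointProcessLaw [IsProbabilityMeasure P] [IsProbabilityMeasure F]
    [IsProbabilityMeasure G] (hF : ∀ᵐ x ∂F, 0 < x)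
    (hG : ∀ᵐ x ∂G, x ∈ Icc (0 : ℝ) 1) (hT : IsStationaryRenewal T F P) (hb : IsIID b G P)
    (hTb : IndepSeq T b P)
    (h : SamePointProcessLaw (fun ω => range fun k => divisionPoint b T k ω) P
      (fun ω => range fun k => T k ω) P) : FixedPointAlternatives F G := by
  obtain ⟨ρ, hρ0, hρ⟩ := hT.palm.exists_palmMeasure_eq hT.enumeration.measurable
  have hD := palmMeasure_divisionPoint hT.enumeration.measurable hb hTb hρ
  have hDe := isPointEnumeration_divisionPoint hT.enumeration hb hG hD
    (dividedGapLaw_eq_zero_of_samePointProcessLaw hG hT.enumeration hb hρ0 hρ hD h)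
  have hnext := map_nextPoints_eq hDe hT.enumeration h
  have hsub : ∀ M : Measure (ℝ × (ℤ → ℝ)), (M.map nextPoints).map
      (fun v => (v 1 - v 0, v 2 - v 1)) = M.map fun p => (p.2 2, p.2 3) := by
    intro M
    rw [Measure.map_map (by fun_prop) measurable_nextPoints]
    congr 1
    funext p
    exact nextPoints_sub p
  have hgaps := congrArg (Measure.map fun v : Fin 3 → ℝ => (v 1 - v 0, v 2 - v 1)) hnext
  have hindF : IndepFun (fun g : ℤ → ℝ => g 0) (fun g => (g 2, g 3))
      (Measure.infinitePi fun _ : ℤ => F) :=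
    ((iIndepFun_infinitePi (P := fun _ : ℤ => F) (X := fun _ x => x)
      (by fun_prop)).indepFun_prodMk (by fun_prop) 2 3 0 (by norm_num) (by norm_num)).symm
  rw [hsub, hsub, hD, hρ, map_gaps_restrict_firstPointSet (hD ▸ palmMeasure_firstPointSet hDe)
      (indepFun_dividedGapLaw F G),
    map_gaps_restrict_firstPointSet (hρ ▸ palmMeasure_firstPointSet hT.enumeration) hindF,
    Measure.infinitePi_map_eval_prod (P := fun _ : ℤ => F) (by norm_num), dividedGapLaw_eq_map,
    Measure.map_map (by fun_prop) (by fun_prop)] at hgaps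
  exact alternatives_of_consecutive hF hG 1 hgaps

end

theorem theorem1 (F G : Measure ℝ) [IsProbabilityMeasure F] [IsProbabilityMeasure G]
    (hFpos : ∀ᵐ x ∂F, 0 < x) (hFint : Integrable (fun x : ℝ => x) F)
    (hG : ∀ᵐ x ∂G, x ∈ Icc (0 : ℝ) 1) :
    (∀ {Ω : Type*} [MeasurableSpace Ω] (P : Measure Ω) [IsProbabilityMeasure P]
        (τ b : ℤ → Ω → ℝ), IsIID τ F P → IsIID b G P → IndepSeq τ b P →
      (IdentDistrib (fun ω => exchange (fun k => b k ω) (fun k => τ k ω))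
          (fun ω k => τ k ω) P P ↔
        FixedPointAlternatives F G)) ∧
    (∀ {Ω : Type*} [MeasurableSpace Ω] (P : Measure Ω) [IsProbabilityMeasure P]
        (T b : ℤ → Ω → ℝ), IsStationaryRenewal T F P → IsIID b G P → IndepSeq T b P →
      (SamePointProcessLaw (fun ω => divisionPoints (fun k => b k ω) (fun k => T k ω)) P
          (fun ω => range fun k => T k ω) P ↔
        FixedPointAlternatives F G)) :=
  ⟨fun _ _ _ _ hτ hb hτb =>
    (identDistrib_exchange_iff hτ hb hτb).trans (exchangeLaw_eq_infinitePi_iff hFpos hG),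
  fun _ _ _ _ hT hb hTb =>
    ⟨alternatives_of_samePointProcessLaw hFpos hG hT hb hTb,
      samePointProcessLaw_of_alternatives hFpos hG hT hb hTb⟩⟩
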